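/- Throughout, $c(x,y)=d(x,y)=\|x-y\|_2$ in $\mathbb R^d$, and $c(j,S)=\min_{i\in S}c(j,i)$. Put $\delta_1=\sqrt2$, $\delta_2=1.395$, $\delta_3=2-\sqrt2$. **Setting.** Let $\mathcal D$ be a set of clients and $\mathcal V$ a finite set of facilities, all of them points of some $\mathbb R^d$ (repetitions allowed). Let $\alpha_j\ge 0$ ($j\in\mathcal D$) and $t_i\ge0$ ($i\in\mathcal V$) be reals, and for each client $j$ let $N(j)\subseteq\mathcal V$ and $w(j)\in\mathcal V$ be such that (1) $\alpha_j\ge t_{w(j)}$ and $\alpha_j\ge c(j,w(j))$; (2) $t_i\ge\alpha_j>c(j,i)$ for every $i\in N(j)$. For $\delta>0$ let $H(\delta)$ be the graph on $\mathcal V$ in which distinct $i,i'$ are adjacent iff $c(i,i')\le\delta\min(t_i,t_{i'})$. **Algorithm** (with parameter $p$, on a vertex set $V_1$). Let $I_1$ be any maximal independent set of $H(\delta_1)$ on $V_1$. Let $V_2$ be the set of points of $V_1\setminus I_1$ that are not adjacent in $H(\delta_2)$ to a point of $I_1$, and $I_2$ any maximal independent set of $H(\delta_1)[V_2]$. Let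 $V_3$ be the set of points of $V_2\setminus I_2$ that have exactly one neighbour in $I_2$ in $H(\delta_1)$, no neighbour in $I_1$ in $H(\delta_2)$, and no neighbour in $I_2$ in $H(\delta_3)$, and $I_3$ any maximal independent set of $H(\delta_1)[V_3]$. For $i\in I_3$ let $q(i)$ be its unique neighbour in $I_2$ in $H(\delta_1)$. The random set $S$ contains all of $I_1$; independently for each $i\in I_2$ a fair coin is flipped, and on heads $i$ is put into $S$ with probability $2p$, while on tails each point of $q^{-1}(i)$ is put into $S$ independently with probability $2p$. **Theorem.** There is a function $\rho$ of $p$ alone such that the following hold. (a) For every $0\le p<0.337$, in every setting as above and for every choice of the maximal independent sets, the random set $S$ produced by the algorithm on $V_1=\mathcal V$ satisfies, for every $j\in\mathcal D$, $$\mathbb E[c(j,S)]\le\rho(p)\cdot\mathbb E\Big[\alpha_j-\sum_{i\in N(j)\cap S}(\alpha_j-c(j,i))\Big].$$ (b) $\rho(0.068)\le2.395$. (c) Consequently the algorithm with $p=0.068$ gives an LMP $2.395$-approximation (in expectation) for Euclidean $k$-median: let $\mathcal D$ be a finite set of clients, $\mathcal F$ a finite nonempty set of facilities in $\mathbb R^d$,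 and $\lambda\ge0$. Grow all $\alpha_j$ from $0$ at unit rate, stopping $\alpha_j$ at the first time at which some facility $i$ with $c(j,i)\le\alpha_j$ is tight, i.e. $\sum_{j'\in\mathcal D}\max(\alpha_{j'}-c(j',i),0)$ has reached $\lambda$. This process determines a unique $\alpha$. Run the algorithm with $p=0.068$ on the set $V_1$ of tight facilities, with $t_i=\max\{\alpha_j: \alpha_j>c(j,i)\}$ ($t_i=0$ if there is no such $j$). Then $$\mathbb E\Big[\sum_{j\in\mathcal D}c(j,S)\Big]\le2.395\cdot\big(\mathrm{OPT}(\lambda)-\lambda\,\mathbb E|S|\big),$$ where $\mathrm{OPT}(\lambda)$ is the minimum of $\sum_{i,j}x_{i,j}c(j,i)+\lambda\sum_iy_i$ over real $x,y$ with $\sum_ix_{i,j}\ge1$ for all $j$, and $0\le x_{i,j}\le y_i$ for all $i,j$, and $y_i\ge0$. -/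

import Mathlib

namespace EuclideanKMedian

noncomputable section

/-- The Euclidean space `ℝ^d`. Clients `j : D` sit at `x j` and facilities `i : F` at `y i`;
the `k`-median connection cost is `c(j, i) = dist (x j) (y i)`. -/
abbrev Point (d : ℕ) : Type := EuclideanSpace ℝ (Fin d)

variable {d : ℕ} {D F : Type}

/-- `c(j, S)`, the distance from client `j` to the nearest facility of `S`. -/
def clientCost (x : D → Point d) (y : F → Point d) (j : D) (S : Finset F) : ℝ :=
  Metric.infDist (x j) (y '' (S : Set F))

/-- The conflict graph `H(δ)`. -/
def conflictGraph (y : F → Point d) (t : F → ℝ) (δ : ℝ) : SimpleGraph F where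
  Adj i i' := i ≠ i' ∧ dist (y i) (y i') ≤ δ * min (t i) (t i')
  symm := ⟨fun i i' h => ⟨h.1.symm, by rw [dist_comm, min_comm]; exact h.2⟩⟩
  loopless := ⟨fun _ h => h.1 rfl⟩

/-- `I` is a maximal independent set of the induced subgraph `G[V]`. -/
def IsMaximalIndepIn (G : SimpleGraph F) (V I : Finset F) : Prop :=
  Maximal (fun s : Finset F => s ⊆ V ∧ G.IsIndepSet (s : Set F)) I

open scoped Classical in
/-- `V₂`: the points of `V₁ \ I₁` with no neighbour in `I₁` in `H(δ₂)`. -/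
def secondLayer (H : ℝ → SimpleGraph F) (δ₂ : ℝ) (V₁ I₁ : Finset F) : Finset F :=
  (V₁ \ I₁).filter fun i => ∀ i₁ ∈ I₁, ¬ (H δ₂).Adj i i₁

open scoped Classical in
/-- `V₃`: the points of `V₂ \ I₂` with exactly one neighbour in `I₂` in `H(δ₁)`, no neighbour in
`I₁` in `H(δ₂)`, and no neighbour in `I₂` in `H(δ₃)`. -/
def thirdLayer (H : ℝ → SimpleGraph F) (δ₁ δ₂ δ₃ : ℝ) (V₁ I₁ I₂ : Finset F) : Finset F :=
  (secondLayer H δ₂ V₁ I₁ \ I₂).filter fun i =>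
    (∃! i₂, i₂ ∈ I₂ ∧ (H δ₁).Adj i i₂) ∧
    (∀ i₁ ∈ I₁, ¬ (H δ₂).Adj i i₁) ∧
    (∀ i₂ ∈ I₂, ¬ (H δ₃).Adj i i₂)

/-- `(I₁, I₂, I₃)` is a possible outcome of the deterministic steps of the `k`-median variant of
the nested quasi-independent set algorithm on the vertex set `V₁`. -/
structure IsNestedQuasiIndep (H : ℝ → SimpleGraph F) (δ₁ δ₂ δ₃ : ℝ) (V₁ I₁ I₂ I₃ : Finset F) :
    Prop where
  first : IsMaximalIndepIn (H δ₁) V₁ I₁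
  second : IsMaximalIndepIn (H δ₁) (secondLayer H δ₂ V₁ I₁) I₂
  third : IsMaximalIndepIn (H δ₁) (thirdLayer H δ₁ δ₂ δ₃ V₁ I₁ I₂) I₃

open scoped Classical in
/-- The set of centers produced when `heads ⊆ I₂` is the set of points whose coin lands heads and
`marked ⊆ I₂ ∪ I₃` is the set of points whose own inclusion trial succeeds. Here `G = H(δ₁)`, in
which every `i ∈ I₃` has exactly one neighbour `q(i) ∈ I₂`. -/
def centers (G : SimpleGraph F) (I₁ I₂ I₃ heads marked : Finset F) : Finset F :=
  I₁ ∪ I₂.filter (fun i => i ∈ heads ∧ i ∈ marked) ∪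
    I₃.filter (fun i => (∃ i₂ ∈ I₂, G.Adj i i₂ ∧ i₂ ∉ heads) ∧ i ∈ marked)

open scoped Classical in
/-- The probability that independent trials with success probability `r`, one for each element of
`U`, succeed exactly on `M ⊆ U`. -/
def trialProb (r : ℝ) (U M : Finset F) : ℝ :=
  ∏ i ∈ U, if i ∈ M then r else 1 - r

open scoped Classical in
/-- `𝔼[f(S)]` for the random set `S` of centers: each `i ∈ I₂` flips a fair coin, each
`i ∈ I₂ ∪ I₃` has an inclusion trial of probability `2p`, all of them independent. -/
def expect (G : SimpleGraph F) (p : ℝ) (I₁ I₂ I₃ : Finset F) (f : Finset F → ℝ) : ℝ :=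
  ∑ heads ∈ I₂.powerset, ∑ marked ∈ (I₂ ∪ I₃).powerset,
    trialProb (1 / 2) I₂ heads * trialProb (2 * p) (I₂ ∪ I₃) marked *
      f (centers G I₁ I₂ I₃ heads marked)

/-- The standing assumptions on `𝒱`, `α`, `t`, the sets `N(j)` and the witnesses `w(j)`. -/
structure WitnessSetup (x : D → Point d) (y : F → Point d) (V : Finset F)
    (α : D → ℝ) (t : F → ℝ) (N : D → Finset F) (w : D → F) : Prop where
  alpha_nonneg : ∀ j, 0 ≤ α j
  t_nonneg : ∀ i ∈ V, 0 ≤ t i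
  nbr_subset : ∀ j, N j ⊆ V
  witness_mem : ∀ j, w j ∈ V
  t_witness_le : ∀ j, t (w j) ≤ α j
  dist_witness_le : ∀ j, dist (x j) (y (w j)) ≤ α j
  alpha_le_t : ∀ j, ∀ i ∈ N j, α j ≤ t i
  dist_lt_alpha : ∀ j, ∀ i ∈ N j, dist (x j) (y i) < α j

variable [Fintype D] [Fintype F]

/-- Feasibility for the linear program `LP'(λ)`: `X i j` is the assignment of client `j` to
facility `i`, and `Y i` the opening of facility `i`. -/
structure LPFeasible (X : F → D → ℝ) (Y : F → ℝ) : Prop where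
  assigned : ∀ j, 1 ≤ ∑ i, X i j
  assign_nonneg : ∀ i j, 0 ≤ X i j
  assign_le : ∀ i j, X i j ≤ Y i
  open_nonneg : ∀ i, 0 ≤ Y i

/-- The objective of `LP'(λ)`. -/
def lpValue (x : D → Point d) (y : F → Point d) (lam : ℝ) (X : F → D → ℝ) (Y : F → ℝ) : ℝ :=
  (∑ i, ∑ j, X i j * dist (x j) (y i)) + lam * ∑ i, Y i

/-- `OPT(λ)`, the optimum of `LP'(λ)`. -/
def opt (x : D → Point d) (y : F → Point d) (lam : ℝ) : ℝ :=
  sInf {v | ∃ X Y, LPFeasible X Y ∧ v = lpValue x y lam X Y}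

/-- The left-hand side of the dual constraint of facility `i`. -/
def dualLoad (x : D → Point d) (y : F → Point d) (α : D → ℝ) (i : F) : ℝ :=
  ∑ j, max (α j - dist (x j) (y i)) 0

/-- `α` is the dual solution produced by the primal-dual growing process. At time `θ` client `j`
has the value `min θ (α j)`: it grows at unit rate from `0` and stops, with final value `α j`, at
the first time `θ` at which some facility `i` with `c(j, i) ≤ θ` is tight, that is, the load of
`i` has reached `λ`. (Either `i` becomes tight at that moment, or it was tight already and
`θ = c(j, i)`.) -/
def IsDualGrowth (x : D → Point d) (y : F → Point d) (lam : ℝ) (α : D → ℝ) : Prop :=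
  ∀ j, IsLeast {θ : ℝ | 0 ≤ θ ∧
    ∃ i, lam ≤ dualLoad x y (fun j' => min θ (α j')) i ∧ dist (x j) (y i) ≤ θ} (α j)

open scoped Classical in
/-- The tight facilities. -/
def tightFacilities (x : D → Point d) (y : F → Point d) (lam : ℝ) (α : D → ℝ) : Finset F :=
  Finset.univ.filter fun i => dualLoad x y α i = lam

open scoped Classical in
/-- `N(i)`, the clients `j` with `α_j > c(j, i)`. -/
def facilityNbrs (x : D → Point d) (y : F → Point d) (α : D → ℝ) (i : F) : Finset D :=
  Finset.univ.filter fun j => dist (x j) (y i) < α j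

open scoped Classical in
/-- `t_i`, the maximum of `α_j` over `j ∈ N(i)`, and `0` if `N(i)` is empty. -/
def facilityTime (x : D → Point d) (y : F → Point d) (α : D → ℝ) (i : F) : ℝ :=
  if h : (facilityNbrs x y α i).Nonempty then (facilityNbrs x y α i).sup' h α else 0

end

end EuclideanKMedian

namespace EuclideanKMedian

/-! ### The random choices of the algorithm -/

section Trials

variable {F : Type}

/-! By scaling, a client may be placed at the origin with `α = 1`. Points of `N` have `t ≥ 1`, so
those in one independent set are pairwise at distance at least `√2`. Packing then bounds the total
depth `∑ (1 - ‖z i‖)` of such a set by 1, and by `2 - √2` unless it is a single point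
(`sum_one_sub_norm_le_of_two_le_card`). Each point of `I₂` and `I₃` is opened with probability `p`,
so by linearity the expectation on the right is `1 - depth I₁ - p * (depth I₂ + depth I₃)`.

If `N` meets `I₁`, the nearest such point bounds the cost, and the depth bounds keep the right side
comparable with its norm (`expect_le_of_exists_first`).

If `N` misses `I₁`, the witness `w` only guarantees a center within `1 + √2`, slightly more than
2.395. The excess occurs only when `w` lies in the second layer. Then some `u ∈ I₂` is near `w`, and
since `u` is not `H(1.395)`-adjacent to the point `k ∈ I₁` near `w`, the two cannot both be far from
the client: `0.932 * ‖z k‖ + 0.068 * ‖z u‖ ≤ 2.395` (`weighted_norm_add_le`). This settles the case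
where `N` also misses `I₂` and `I₃`. If it contains exactly one of their points, `v`, and `v` is not
too close to the client, the crude radius suffices; otherwise a point `u ≠ v` near `w` is needed
whose opening is not positively correlated with that of `v`. Providing it is the role of `I₃` and of
the shared coin (`exists_second_near`). With two or more points of `N`, their separation and the
depth bounds leave enough room.

For the approximation guarantee, the growing process yields a feasible dual solution whose stopping
facilities are the witnesses; the clients pay exactly `λ` for each tight facility, and weak duality
finishes. -/

open scoped Classical in
-- Independence: the expectation of a product with one factor per trial is the product of the
-- expectations. It is the expansion of a product of sums over subsets.
theorem sum_trialProb_mul_prod (r : ℝ) (U : Finset F) (φ ψ : F → ℝ) :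
    ∑ M ∈ U.powerset, trialProb r U M * ∏ i ∈ U, (if i ∈ M then φ i else ψ i) =
      ∏ i ∈ U, (r * φ i + (1 - r) * ψ i) := by
  rw [Finset.prod_add]
  refine Finset.sum_congr rfl fun M hM => ?_
  rw [Finset.mem_powerset] at hM
  have h : ∀ i ∈ U, (if i ∈ M then r else 1 - r) * (if i ∈ M then φ i else ψ i) =
      if i ∈ M then r * φ i else (1 - r) * ψ i := by
    intro i _
    split_ifs <;> rfl
  rw [trialProb, ← Finset.prod_mul_distrib, Finset.prod_congr rfl h, Finset.prod_ite]
  congr 1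
  · refine Finset.prod_congr ?_ fun _ _ => rfl
    ext i
    simp only [Finset.mem_filter]
    exact ⟨fun h => h.2, fun h => ⟨hM h, h⟩⟩
  · refine Finset.prod_congr ?_ fun _ _ => rfl
    ext i
    simp only [Finset.mem_filter, Finset.mem_sdiff]

open scoped Classical in
/-- The probability that the trials of `A` all succeed and those of `B` all fail. -/
theorem sum_trialProb_mul_event (r : ℝ) {U A B : Finset F} (hA : A ⊆ U) (hB : B ⊆ U)
    (hAB : Disjoint A B) :
    ∑ M ∈ U.powerset, trialProb r U M * (if A ⊆ M ∧ Disjoint B M then 1 else 0) =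
      r ^ A.card * (1 - r) ^ B.card := by
  -- A factor 0 on each forbidden outcome, success on `B` and failure on `A`, makes the product the
  -- indicator of the event.
  have key := sum_trialProb_mul_prod r U (fun i => if i ∈ B then 0 else 1)
    (fun i => if i ∈ A then 0 else 1)
  have hR : ∏ i ∈ U, (r * (if i ∈ B then (0 : ℝ) else 1) +
      (1 - r) * (if i ∈ A then (0 : ℝ) else 1)) = r ^ A.card * (1 - r) ^ B.card := by
    have h : ∀ i ∈ U, (r * (if i ∈ B then (0 : ℝ) else 1) +
        (1 - r) * (if i ∈ A then (0 : ℝ) else 1)) =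
        (if i ∈ A then r else 1) * (if i ∈ B then 1 - r else 1) := by
      intro i _
      by_cases h1 : i ∈ A
      · have h2 : i ∉ B := Finset.disjoint_left.1 hAB h1
        simp [h1, h2]
      · by_cases h2 : i ∈ B <;> simp [h1, h2]
    rw [Finset.prod_congr rfl h, Finset.prod_mul_distrib, Finset.prod_ite_mem,
      Finset.prod_ite_mem, Finset.inter_eq_right.2 hA, Finset.inter_eq_right.2 hB,
      Finset.prod_const, Finset.prod_const]
  rw [← hR, ← key]
  refine Finset.sum_congr rfl fun M _ => ?_
  congr 1
  split_ifs with h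
  · symm
    refine Finset.prod_eq_one fun i _ => ?_
    by_cases hi : i ∈ M
    · have : i ∉ B := Finset.disjoint_right.1 h.2 hi
      simp [hi, this]
    · have : i ∉ A := fun h' => hi (h.1 h')
      simp [hi, this]
  · symm
    rw [Finset.prod_eq_zero_iff]
    by_cases hs : A ⊆ M
    · have : ¬ Disjoint B M := fun h' => h ⟨hs, h'⟩
      obtain ⟨i, hi, hi'⟩ := Finset.not_disjoint_iff.1 this
      exact ⟨i, hB hi, by simp [hi, hi']⟩
    · obtain ⟨i, hi, hi'⟩ := Finset.not_subset.1 hs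
      exact ⟨i, hA hi, by simp [hi, hi']⟩

theorem sum_trialProb (r : ℝ) (U : Finset F) : ∑ M ∈ U.powerset, trialProb r U M = 1 := by
  simpa using sum_trialProb_mul_event r (U := U) (Finset.empty_subset U) (Finset.empty_subset U)
    (Finset.disjoint_empty_left _)

theorem trialProb_nonneg {r : ℝ} (h0 : 0 ≤ r) (h1 : r ≤ 1) (U M : Finset F) :
    0 ≤ trialProb r U M := by
  refine Finset.prod_nonneg fun i _ => ?_
  split_ifs
  · exact h0
  · linarith

end Trials

/-! ### Expectation over the random set of centers -/

section Expect

variable {F : Type} {G : SimpleGraph F} {p : ℝ} {I₁ I₂ I₃ : Finset F}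

theorem expect_add (f g : Finset F → ℝ) :
    expect G p I₁ I₂ I₃ (fun S => f S + g S) =
      expect G p I₁ I₂ I₃ f + expect G p I₁ I₂ I₃ g := by
  simp only [expect, mul_add, Finset.sum_add_distrib]

theorem expect_const_mul (c : ℝ) (f : Finset F → ℝ) :
    expect G p I₁ I₂ I₃ (fun S => c * f S) = c * expect G p I₁ I₂ I₃ f := by
  simp only [expect, Finset.mul_sum]
  refine Finset.sum_congr rfl fun _ _ => Finset.sum_congr rfl fun _ _ => by ring

theorem expect_sub (f g : Finset F → ℝ) :
    expect G p I₁ I₂ I₃ (fun S => f S - g S) =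
      expect G p I₁ I₂ I₃ f - expect G p I₁ I₂ I₃ g := by
  simp only [expect, mul_sub, Finset.sum_sub_distrib]

theorem expect_sum {ι : Type*} (s : Finset ι) (f : ι → Finset F → ℝ) :
    expect G p I₁ I₂ I₃ (fun S => ∑ k ∈ s, f k S) = ∑ k ∈ s, expect G p I₁ I₂ I₃ (f k) := by
  classical
  induction s using Finset.induction_on with
  | empty => simp [expect]
  | insert a s ha ih => simp only [Finset.sum_insert ha, expect_add, ih]

theorem expect_const (c : ℝ) : expect G p I₁ I₂ I₃ (fun _ => c) = c := by
  classical
  simp only [expect, ← Finset.sum_mul, ← Finset.mul_sum, sum_trialProb]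
  ring

theorem expect_mono (h0 : 0 ≤ p) (h1 : 2 * p ≤ 1) {f g : Finset F → ℝ}
    (h : ∀ heads ⊆ I₂, ∀ marked, f (centers G I₁ I₂ I₃ heads marked) ≤
      g (centers G I₁ I₂ I₃ heads marked)) :
    expect G p I₁ I₂ I₃ f ≤ expect G p I₁ I₂ I₃ g := by
  refine Finset.sum_le_sum fun A hA => Finset.sum_le_sum fun B _ => ?_
  refine mul_le_mul_of_nonneg_left (h A (Finset.mem_powerset.1 hA) B) (mul_nonneg ?_ ?_)
  · exact trialProb_nonneg (by norm_num) (by norm_num) _ _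
  · exact trialProb_nonneg (by linarith) h1 _ _

open scoped Classical in
-- Coins and inclusion trials are independent, so the probability factors; the coins being fair,
-- prescribed heads and prescribed tails weigh the same.
theorem expect_eq_of_event {f : Finset F → ℝ} {A B C : Finset F} (hA : A ⊆ I₂) (hB : B ⊆ I₂)
    (hAB : Disjoint A B) (hC : C ⊆ I₂ ∪ I₃)
    (h : ∀ heads ⊆ I₂, ∀ marked, f (centers G I₁ I₂ I₃ heads marked) =
      (if A ⊆ heads ∧ Disjoint B heads then 1 else 0) * (if C ⊆ marked then 1 else 0)) :
    expect G p I₁ I₂ I₃ f = (1 / 2) ^ (A.card + B.card) * (2 * p) ^ C.card := by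
  have e1 := sum_trialProb_mul_event (1 / 2 : ℝ) hA hB hAB
  have e2 := sum_trialProb_mul_event (2 * p) hC (Finset.empty_subset (I₂ ∪ I₃))
    (Finset.disjoint_empty_right _)
  simp only [Finset.disjoint_empty_left, and_true, Finset.card_empty, pow_zero, mul_one] at e2
  have e3 : (1 - 1 / 2 : ℝ) = 1 / 2 := by norm_num
  rw [e3] at e1
  rw [pow_add, ← e1, ← e2, expect, Finset.sum_mul_sum]
  refine Finset.sum_congr rfl fun heads hh => Finset.sum_congr rfl fun marked _ => ?_
  rw [h heads (Finset.mem_powerset.1 hh) marked]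
  ring

open scoped Classical in
/-- The indicator of the event `i ∈ S`. -/
noncomputable def indic (i : F) (S : Finset F) : ℝ := if i ∈ S then 1 else 0

theorem indic_of_mem {i : F} {S : Finset F} (h : i ∈ S) : indic i S = 1 := if_pos h

theorem indic_of_notMem {i : F} {S : Finset F} (h : i ∉ S) : indic i S = 0 := if_neg h

theorem mem_centers {heads marked : Finset F} {i : F} :
    i ∈ centers G I₁ I₂ I₃ heads marked ↔ i ∈ I₁ ∨ (i ∈ I₂ ∧ i ∈ heads ∧ i ∈ marked) ∨
      (i ∈ I₃ ∧ (∃ k ∈ I₂, G.Adj i k ∧ k ∉ heads) ∧ i ∈ marked) := by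
  simp only [centers, Finset.mem_union, Finset.mem_filter, or_assoc]

end Expect

end EuclideanKMedian

namespace EuclideanKMedian

/-! ### Well-separated points in the unit ball -/

section Geometry

theorem sqrt_two_le_norm_add_norm {E : Type*} [SeminormedAddCommGroup E] {u v : E}
    (h : 2 ≤ ‖u - v‖ ^ 2) : √2 ≤ ‖u‖ + ‖v‖ :=
  (Real.sqrt_le_left (norm_nonneg _) |>.2 h).trans (norm_sub_le u v)

variable {E : Type*} [NormedAddCommGroup E] [InnerProductSpace ℝ E] {ι : Type*}

/-- The two sides differ by `2 * ‖∑ c i • z i‖ ^ 2`. -/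
theorem sum_sum_weighted_dist_sq_le (P : Finset ι) (z : ι → E) (c : ι → ℝ) :
    ∑ i ∈ P, ∑ k ∈ P, c i * c k * ‖z i - z k‖ ^ 2 ≤
      2 * (∑ i ∈ P, c i) * ∑ i ∈ P, c i * ‖z i‖ ^ 2 := by
  have h : ∀ i k, c i * c k * ‖z i - z k‖ ^ 2 =
      (c i * ‖z i‖ ^ 2) * c k + c i * (c k * ‖z k‖ ^ 2) - 2 * inner ℝ (c i • z i) (c k • z k) := by
    intro i k
    rw [norm_sub_sq_real, inner_smul_left, inner_smul_right]
    simp only [conj_trivial]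
    ring
  have h2 : ∑ i ∈ P, ∑ k ∈ P, inner ℝ (c i • z i) (c k • z k) = ‖∑ i ∈ P, c i • z i‖ ^ 2 := by
    rw [← real_inner_self_eq_norm_sq, sum_inner]
    simp only [inner_sum]
  simp only [h, Finset.sum_sub_distrib, Finset.sum_add_distrib, ← Finset.mul_sum, ← Finset.sum_mul,
    h2]
  nlinarith [sq_nonneg ‖∑ i ∈ P, c i • z i‖]

/-- With unit weights and `n` points, the separation makes the double sum at least `2 * n * (n -
1)`, hence `∑ ‖z i‖ ^ 2 ≥ n - 1`. -/
theorem sum_one_sub_norm_sq_le_one {P : Finset ι} {z : ι → E}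
    (hsep : ∀ i ∈ P, ∀ k ∈ P, i ≠ k → 2 ≤ ‖z i - z k‖ ^ 2) :
    ∑ i ∈ P, (1 - ‖z i‖ ^ 2) ≤ 1 := by
  classical
  rcases P.eq_empty_or_nonempty with rfl | hne
  · simp
  have h := sum_sum_weighted_dist_sq_le P z (fun _ => 1)
  have h1 : ∑ i ∈ P, ∑ k ∈ P, (2 - if i = k then (2 : ℝ) else 0) ≤
      ∑ i ∈ P, ∑ k ∈ P, (1 : ℝ) * 1 * ‖z i - z k‖ ^ 2 := by
    refine Finset.sum_le_sum fun i hi => Finset.sum_le_sum fun k hk => ?_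
    split_ifs with hik
    · subst hik
      simp
    · simpa using hsep i hi k hk hik
  simp only [Finset.sum_sub_distrib, Finset.sum_const, nsmul_eq_mul, Finset.sum_ite_eq] at h1
  have h2 : ∑ i ∈ P, (if i ∈ P then (2 : ℝ) else 0) = P.card * 2 := by
    rw [Finset.sum_congr rfl (fun i hi => if_pos hi)]
    simp
  rw [h2] at h1
  simp only [one_mul, mul_one, Finset.sum_const, nsmul_eq_mul] at h h1
  have hn : (0 : ℝ) < P.card := by exact_mod_cast hne.card_pos
  rw [Finset.sum_sub_distrib, Finset.sum_const, nsmul_eq_mul, mul_one]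
  have := h1.trans h
  have h3 : (P.card : ℝ) * (2 * (P.card - 1 - ∑ i ∈ P, ‖z i‖ ^ 2)) ≤ 0 := by nlinarith
  have h4 := nonpos_of_mul_nonpos_right h3 hn
  linarith

/-- The factorisation `1 - ‖z i‖ ^ 2 = (1 + ‖z i‖) * (1 - ‖z i‖)` turns the quadratic packing bound
into a bound on the depth, which improves as the points move outwards. -/
theorem sum_one_sub_norm_le_inv {P : Finset ι} {z : ι → E} {m : ℝ}
    (hsep : ∀ i ∈ P, ∀ k ∈ P, i ≠ k → 2 ≤ ‖z i - z k‖ ^ 2)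
    (hmin : ∀ i ∈ P, m ≤ ‖z i‖) (hlt : ∀ i ∈ P, ‖z i‖ ≤ 1) :
    (1 + m) * ∑ i ∈ P, (1 - ‖z i‖) ≤ 1 := by
  refine le_trans ?_ (sum_one_sub_norm_sq_le_one hsep)
  rw [Finset.mul_sum]
  refine Finset.sum_le_sum fun i hi => ?_
  nlinarith [mul_nonneg (sub_nonneg.2 (hmin i hi)) (sub_nonneg.2 (hlt i hi))]

/-- A weighted form of `sum_one_sub_norm_sq_le_one`, with weight `3/2` on one point. -/
theorem sum_one_sub_norm_sq_le_of_insert [DecidableEq ι] {P : Finset ι} {z : ι → E} {v : ι}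
    (hv : v ∉ P) (hP : 2 ≤ P.card)
    (hsep : ∀ i ∈ insert v P, ∀ k ∈ insert v P, i ≠ k → 2 ≤ ‖z i - z k‖ ^ 2) :
    ∑ i ∈ P, (1 - ‖z i‖ ^ 2) ≤ 3 / 2 * ‖z v‖ ^ 2 - 2 / 7 := by
  have h := sum_sum_weighted_dist_sq_le (insert v P) z (fun i => if i = v then 3 / 2 else 1)
  have hne : ∀ i ∈ P, i ≠ v := fun i hi h => hv (h ▸ hi)
  have hc : ∑ i ∈ P, (if i = v then (3 / 2 : ℝ) else 1) = P.card := by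
    rw [Finset.sum_congr rfl fun i hi => if_neg (hne i hi)]
    simp
  have hd : ∑ i ∈ P, (if i = v then (3 / 2 : ℝ) else 1) * ‖z i‖ ^ 2 = ∑ i ∈ P, ‖z i‖ ^ 2 := by
    refine Finset.sum_congr rfl fun i hi => ?_
    rw [if_neg (hne i hi), one_mul]
  rw [Finset.sum_insert hv, Finset.sum_insert hv, Finset.sum_insert hv, Finset.sum_insert hv,
    hc, hd] at h
  simp only [if_true, sub_self, norm_zero] at h
  have a1 : ∑ k ∈ P, (3 : ℝ) ≤
      ∑ k ∈ P, 3 / 2 * (if k = v then (3 / 2 : ℝ) else 1) * ‖z v - z k‖ ^ 2 := by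
    refine Finset.sum_le_sum fun k hk => ?_
    rw [if_neg (hne k hk)]
    have := hsep v (Finset.mem_insert_self _ _) k (Finset.mem_insert_of_mem hk) (hne k hk).symm
    linarith
  have a2 : ∑ i ∈ P, ((3 : ℝ) + ∑ k ∈ P, (2 - if i = k then (2 : ℝ) else 0)) ≤
      ∑ i ∈ P, ∑ k ∈ insert v P, (if i = v then (3 / 2 : ℝ) else 1) *
        (if k = v then (3 / 2 : ℝ) else 1) * ‖z i - z k‖ ^ 2 := by
    refine Finset.sum_le_sum fun i hi => ?_
    rw [Finset.sum_insert hv, if_neg (hne i hi), if_pos rfl]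
    refine add_le_add ?_ (Finset.sum_le_sum fun k hk => ?_)
    · have := hsep i (Finset.mem_insert_of_mem hi) v (Finset.mem_insert_self _ _) (hne i hi)
      linarith
    · rw [if_neg (hne k hk)]
      split_ifs with hik
      · subst hik
        simp
      · have := hsep i (Finset.mem_insert_of_mem hi) k (Finset.mem_insert_of_mem hk) hik
        linarith
  have a3 : ∑ i ∈ P, ((3 : ℝ) + ∑ k ∈ P, (2 - if i = k then (2 : ℝ) else 0)) =
      P.card * (3 + (P.card * 2 - 2)) := by
    have : ∀ i ∈ P, ((3 : ℝ) + ∑ k ∈ P, (2 - if i = k then (2 : ℝ) else 0)) =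
        3 + (P.card * 2 - 2) := by
      intro i hi
      rw [Finset.sum_sub_distrib, Finset.sum_ite_eq, if_pos hi]
      simp
    rw [Finset.sum_congr rfl this, Finset.sum_const, nsmul_eq_mul]
  rw [a3] at a2
  simp only [Finset.sum_const, nsmul_eq_mul] at a1
  rw [Finset.sum_sub_distrib, Finset.sum_const, nsmul_eq_mul, mul_one]
  set n : ℝ := (P.card : ℝ)
  set s : ℝ := ∑ i ∈ P, ‖z i‖ ^ 2
  set r : ℝ := ‖z v‖ ^ 2
  have hn : (2 : ℝ) ≤ n := by simpa [n] using (Nat.cast_le (α := ℝ)).2 hP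
  have hmain : n * 3 + n * (3 + (n * 2 - 2)) ≤ 2 * (3 / 2 + n) * (3 / 2 * r + s) := by
    linarith
  -- By `hmain`, `n - s - 3 / 2 * r ≤ -n / (2 * n + 3)`. The right side is largest at `n = 2`, where
  -- it is `-2 / 7`.
  have : (3 / 2 + n) * (n - s - 3 / 2 * r + 2 / 7) ≤ 0 := by nlinarith
  have := nonpos_of_mul_nonpos_right this (by linarith)
  linarith

/-- At least two points of the unit ball at mutual distance at least `√2` have total depth at
most `2 - √2`. -/
theorem sum_one_sub_norm_le_of_two_le_card {P : Finset ι} {z : ι → E} (hP : 2 ≤ P.card)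
    (hsep : ∀ i ∈ P, ∀ k ∈ P, i ≠ k → 2 ≤ ‖z i - z k‖ ^ 2) (hlt : ∀ i ∈ P, ‖z i‖ ≤ 1) :
    ∑ i ∈ P, (1 - ‖z i‖) ≤ 2 - √2 := by
  classical
  have hs0 : √2 ^ 2 = 2 := Real.sq_sqrt (by norm_num)
  have hs1 : 1.414 ≤ √2 := Real.le_sqrt' (by norm_num) |>.2 (by norm_num)
  have hs2 : √2 ≤ 1.4143 := Real.sqrt_le_left (by norm_num) |>.2 (by norm_num)
  obtain ⟨v, hv, hmin⟩ := P.exists_min_image (fun i => ‖z i‖) (Finset.card_pos.1 (by omega))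
  obtain ⟨Q, hQ, rfl⟩ : ∃ Q, v ∉ Q ∧ P = insert v Q :=
    ⟨P.erase v, Finset.notMem_erase _ _, (Finset.insert_erase hv).symm⟩
  rw [Finset.card_insert_of_notMem hQ] at hP
  set r := ‖z v‖ with hr
  have hr0 : 0 ≤ r := norm_nonneg _
  -- At `r = √2 / 2` the bound `1 / (1 + r)` equals `2 - √2`.
  rcases le_total (√2 / 2) r with h | h
  · have h1 := sum_one_sub_norm_le_inv hsep (fun i hi => h.trans (hmin i hi)) hlt
    have h2 : (1 + √2 / 2) * (2 - √2) = 1 := by nlinarith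
    exact le_of_mul_le_mul_left (h1.trans h2.ge) (by positivity)
  · have hfar : ∀ i ∈ Q, √2 - r ≤ ‖z i‖ := by
      intro i hi
      have := sqrt_two_le_norm_add_norm (hsep v (Finset.mem_insert_self _ _) i
        (Finset.mem_insert_of_mem hi) (fun h => hQ (h ▸ hi)))
      linarith
    rw [Finset.sum_insert hQ]
    rcases Nat.lt_or_ge Q.card 2 with h2 | h2
    · obtain ⟨i, rfl⟩ := Finset.card_eq_one.1 (show Q.card = 1 by omega)
      have := hfar i (Finset.mem_singleton_self _)
      simp only [Finset.sum_singleton]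
      linarith
    -- On `Q` the factor `1 + ‖z i‖` is at least `1 + √2 - r`. The target depth for `Q` is `1 - √2 +
    -- r`, which together with the depth `1 - r` of `v` makes `2 - √2`.
    · have hs := sum_one_sub_norm_sq_le_of_insert hQ h2 hsep
      have hb : (1 + √2 - r) * ∑ i ∈ Q, (1 - ‖z i‖) ≤ ∑ i ∈ Q, (1 - ‖z i‖ ^ 2) := by
        rw [Finset.mul_sum]
        refine Finset.sum_le_sum fun i hi => ?_
        have h3 := hfar i hi
        have h4 := hlt i (Finset.mem_insert_of_mem hi)
        nlinarith [mul_nonneg (sub_nonneg.2 h3) (sub_nonneg.2 h4)]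
      have hr1 : √2 - 1 ≤ r := by
        obtain ⟨i, hi⟩ := Finset.card_pos.1 (show 0 < Q.card by omega)
        have h3 := hfar i hi
        have h4 := hlt i (Finset.mem_insert_of_mem hi)
        linarith
      -- The difference of the sides is a convex quadratic in `r`, so it suffices that it is
      -- nonpositive at both ends of `[√2 - 1, √2 / 2]`.
      have hq : 3 / 2 * r ^ 2 - 2 / 7 ≤ (1 + √2 - r) * (1 - √2 + r) := by
        nlinarith [mul_nonneg (sub_nonneg.2 hr1) (sub_nonneg.2 h)]
      have h5 := le_of_mul_le_mul_left ((hb.trans hs).trans hq) (by linarith)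
      linarith

theorem sum_one_sub_norm_le_one {P : Finset ι} {z : ι → E}
    (hsep : ∀ i ∈ P, ∀ k ∈ P, i ≠ k → 2 ≤ ‖z i - z k‖ ^ 2) (hlt : ∀ i ∈ P, ‖z i‖ ≤ 1) :
    ∑ i ∈ P, (1 - ‖z i‖) ≤ 1 := by
  simpa using sum_one_sub_norm_le_inv (m := 0) hsep (fun i _ => norm_nonneg _) hlt

theorem sum_one_sub_norm_le_of_le_norm {P : Finset ι} {z : ι → E}
    (hsep : ∀ i ∈ P, ∀ k ∈ P, i ≠ k → 2 ≤ ‖z i - z k‖ ^ 2) (hlt : ∀ i ∈ P, ‖z i‖ ≤ 1)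
    (hfar : ∀ i ∈ P, 0.395 ≤ ‖z i‖) :
    ∑ i ∈ P, (1 - ‖z i‖) ≤ 0.605 := by
  rcases Nat.lt_or_ge P.card 2 with h | h
  · rcases Nat.lt_or_ge P.card 1 with h0 | h0
    · rw [Finset.card_eq_zero.1 (show P.card = 0 by omega)]
      norm_num
    · obtain ⟨i, rfl⟩ := Finset.card_eq_one.1 (show P.card = 1 by omega)
      have := hfar i (Finset.mem_singleton_self _)
      simp only [Finset.sum_singleton]
      linarith
  · have hs1 : 1.414 ≤ √2 := Real.le_sqrt' (by norm_num) |>.2 (by norm_num)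
    have := sum_one_sub_norm_le_of_two_le_card h hsep hlt
    linarith

/-- If every point of `P` is at distance at least `1.395` from a point `u`, then the total depth
of `P` is at most a multiple of `‖u‖`. -/
theorem sum_one_sub_norm_le_mul_norm {P : Finset ι} {z : ι → E} {u : E}
    (hsep : ∀ i ∈ P, ∀ k ∈ P, i ≠ k → 2 ≤ ‖z i - z k‖ ^ 2) (hlt : ∀ i ∈ P, ‖z i‖ ≤ 1)
    (hfar : ∀ i ∈ P, 1.395 ≤ ‖z i - u‖) :
    ∑ i ∈ P, (1 - ‖z i‖) ≤ 1.2 * ‖u‖ := by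
  have hu := norm_nonneg u
  rcases Nat.lt_or_ge P.card 2 with h | h
  · rcases Nat.lt_or_ge P.card 1 with h0 | h0
    · rw [Finset.card_eq_zero.1 (show P.card = 0 by omega), Finset.sum_empty]
      positivity
    · obtain ⟨i, rfl⟩ := Finset.card_eq_one.1 (show P.card = 1 by omega)
      have := (hfar i (Finset.mem_singleton_self _)).trans (norm_sub_le _ _)
      simp only [Finset.sum_singleton]
      linarith
  · have hs1 : 1.414 ≤ √2 := Real.le_sqrt' (by norm_num) |>.2 (by norm_num)
    have h1 := sum_one_sub_norm_le_of_two_le_card h hsep hlt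
    obtain ⟨i, hi, k, hk, hik⟩ := Finset.one_lt_card.1 (show 1 < P.card by omega)
    have h2 := hsep i hi k hk hik
    have h3 := hfar i hi
    have h4 := hfar k hk
    have h5 := hlt i hi
    have h6 := hlt k hk
    have h3' : 1.395 ^ 2 ≤ ‖z i - u‖ ^ 2 := by gcongr
    have h4' : 1.395 ^ 2 ≤ ‖z k - u‖ ^ 2 := by gcongr
    have h5' : ‖z i‖ ^ 2 ≤ 1 := pow_le_one₀ (norm_nonneg _) h5
    have h6' : ‖z k‖ ^ 2 ≤ 1 := pow_le_one₀ (norm_nonneg _) h6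
    -- The separations give `⟪z i, z k⟫ ≤ 0` and `⟪z i, u⟫, ⟪z k, u⟫ ≤ (1 + ‖u‖ ^ 2 - 1.395 ^ 2) /
    -- 2`. Expanding this square yields `0 ≤ 15 * ‖u‖ ^ 2 - 3.676`, so `u` is far enough out for the
    -- bound `2 - √2` to be below `1.2 * ‖u‖`.
    have h7 : 0 ≤ ‖z i + z k + (3 : ℝ) • u‖ ^ 2 := sq_nonneg _
    rw [norm_add_sq_real, norm_add_sq_real, inner_add_left, inner_smul_right, inner_smul_right,
      norm_smul, Real.norm_of_nonneg (by norm_num : (0 : ℝ) ≤ 3)] at h7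
    rw [norm_sub_sq_real] at h2 h3' h4'
    have h8 : 0.245 ≤ ‖u‖ ^ 2 := by nlinarith
    have h9 : 0.49 ≤ ‖u‖ := by nlinarith
    linarith

/-- Two points that are near to a common point `e` of the unit ball, but not to each other,
cannot both be far from the origin. -/
theorem weighted_norm_add_le {e a b : E} (he : ‖e‖ ≤ 1) (ha : ‖a‖ ^ 2 ≤ 2) (hb : ‖b‖ ^ 2 ≤ 2)
    (hab : 1.395 ^ 2 / 2 * min (‖a‖ ^ 2) (‖b‖ ^ 2) ≤ ‖a - b‖ ^ 2) :
    0.932 * ‖e + a‖ + 0.068 * ‖e + b‖ ≤ 2.395 := by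
  -- Each norm is linearised by `s ≤ (s ^ 2 + c ^ 2) / (2 * c)`. The tangent points 2.413 and 2.148
  -- are close to the norms in the extremal configuration, where `‖a‖ = ‖b‖ = √2` and `e` is a unit
  -- vector along `m • a + n • b`.
  have h1 : ‖e + a‖ ≤ (‖e + a‖ ^ 2 + 2.413 ^ 2) / (2 * 2.413) := by
    rw [le_div_iff₀ (by norm_num)]
    nlinarith [sq_nonneg (‖e + a‖ - 2.413)]
  have h2 : ‖e + b‖ ≤ (‖e + b‖ ^ 2 + 2.148 ^ 2) / (2 * 2.148) := by
    rw [le_div_iff₀ (by norm_num)]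
    nlinarith [sq_nonneg (‖e + b‖ - 2.148)]
  obtain ⟨m, hm⟩ : ∃ m : ℝ, m = 0.932 / (2 * 2.413) := ⟨_, rfl⟩
  obtain ⟨n, hn⟩ : ∃ n : ℝ, n = 0.068 / (2 * 2.148) := ⟨_, rfl⟩
  have hm0 : 0 < m := by rw [hm]; norm_num
  have hn0 : 0 < n := by rw [hn]; norm_num
  have hE : inner ℝ e (m • a + n • b) ≤ ‖m • a + n • b‖ := by
    refine (real_inner_le_norm _ _).trans ?_
    exact mul_le_of_le_one_left (norm_nonneg _) he
  have hK : ‖m • a + n • b‖ ^ 2 ≤ 2 * m ^ 2 + 2 * n ^ 2 + m * n * (4 - 1.395 ^ 2) := by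
    have : ‖m • a + n • b‖ ^ 2 = m ^ 2 * ‖a‖ ^ 2 + n ^ 2 * ‖b‖ ^ 2 +
        m * n * (‖a‖ ^ 2 + ‖b‖ ^ 2 - ‖a - b‖ ^ 2) := by
      rw [norm_add_sq_real, norm_sub_sq_real, norm_smul, norm_smul, inner_smul_left,
        inner_smul_right, Real.norm_of_nonneg hm0.le, Real.norm_of_nonneg hn0.le]
      simp only [conj_trivial]
      ring
    rw [this]
    -- Since `1.395 ^ 2 / 2 < 1`, the smaller square keeps a positive coefficient, and both squares
    -- may be replaced by 2.
    have h3 : ‖a‖ ^ 2 + ‖b‖ ^ 2 - ‖a - b‖ ^ 2 ≤ 4 - 1.395 ^ 2 := by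
      rcases le_total (‖a‖ ^ 2) (‖b‖ ^ 2) with h | h
      · rw [min_eq_left h] at hab
        linarith
      · rw [min_eq_right h] at hab
        linarith
    have h4 := mul_le_mul_of_nonneg_left h3 (mul_pos hm0 hn0).le
    have h5 := mul_le_mul_of_nonneg_left ha (sq_nonneg m)
    have h6 := mul_le_mul_of_nonneg_left hb (sq_nonneg n)
    linarith
  have hK' : ‖m • a + n • b‖ ≤ 0.28526 := by
    refine abs_le_of_sq_le_sq' (hK.trans ?_) (by norm_num) |>.2
    rw [hm, hn]
    norm_num
  have he2 : ‖e‖ ^ 2 ≤ 1 := pow_le_one₀ (norm_nonneg _) he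
  have hsum : m * ‖e + a‖ ^ 2 + n * ‖e + b‖ ^ 2 = (m + n) * ‖e‖ ^ 2 + m * ‖a‖ ^ 2 + n * ‖b‖ ^ 2 +
      2 * inner ℝ e (m • a + n • b) := by
    rw [norm_add_sq_real, norm_add_sq_real, inner_add_right, inner_smul_right, inner_smul_right]
    ring
  have hsum' : m * ‖e + a‖ ^ 2 + n * ‖e + b‖ ^ 2 ≤ (m + n) + m * 2 + n * 2 + 2 * 0.28526 := by
    rw [hsum]
    have h5 := mul_le_mul_of_nonneg_left ha hm0.le
    have h6 := mul_le_mul_of_nonneg_left hb hn0.le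
    have h7 := mul_le_mul_of_nonneg_left he2 (add_pos hm0 hn0).le
    have h8 := hE.trans hK'
    linarith
  have h8 : 0.932 * ((‖e + a‖ ^ 2 + 2.413 ^ 2) / (2 * 2.413)) +
      0.068 * ((‖e + b‖ ^ 2 + 2.148 ^ 2) / (2 * 2.148)) =
      m * ‖e + a‖ ^ 2 + n * ‖e + b‖ ^ 2 + 0.932 * 2.413 / 2 + 0.068 * 2.148 / 2 := by
    rw [hm, hn]
    ring
  have h9 : (m + n) + m * 2 + n * 2 + 2 * 0.28526 + 0.932 * 2.413 / 2 + 0.068 * 2.148 / 2 ≤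
      2.395 := by
    rw [hm, hn]
    norm_num
  linarith

end Geometry

end EuclideanKMedian

namespace EuclideanKMedian

/-! ### Structure of the nested quasi-independent sets -/

section Layers

variable {F : Type}

theorem IsMaximalIndepIn.not_adj {G : SimpleGraph F} {V I : Finset F} (h : IsMaximalIndepIn G V I)
    {i k : F} (hi : i ∈ I) (hk : k ∈ I) : ¬ G.Adj i k := fun hik =>
  h.prop.2 (Finset.mem_coe.2 hi) (Finset.mem_coe.2 hk) hik.ne hik

theorem IsMaximalIndepIn.exists_near {G : SimpleGraph F} {V I : Finset F}
    (h : IsMaximalIndepIn G V I) {v : F} (hv : v ∈ V) : ∃ i ∈ I, i = v ∨ G.Adj v i := by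
  classical
  by_contra! hcon
  have hvI : v ∉ I := fun hvI => (hcon v hvI).1 rfl
  refine hvI (h.le_of_ge (y := insert v I) ⟨?_, ?_⟩ (Finset.subset_insert v I)
    (Finset.mem_insert_self v I))
  · exact Finset.insert_subset hv h.prop.1
  · rw [Finset.coe_insert]
    refine h.prop.2.insert fun i hi _ => ⟨(hcon i hi).2, fun hadj => (hcon i hi).2 hadj.symm⟩

variable {H : ℝ → SimpleGraph F} {δ₁ δ₂ δ₃ : ℝ} {V I₁ I₂ I₃ : Finset F}

theorem mem_secondLayer {i : F} : i ∈ secondLayer H δ₂ V I₁ ↔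
    (i ∈ V ∧ i ∉ I₁) ∧ ∀ k ∈ I₁, ¬ (H δ₂).Adj i k := by
  simp [secondLayer]

theorem mem_thirdLayer {i : F} : i ∈ thirdLayer H δ₁ δ₂ δ₃ V I₁ I₂ ↔
    (i ∈ secondLayer H δ₂ V I₁ ∧ i ∉ I₂) ∧ (∃! k, k ∈ I₂ ∧ (H δ₁).Adj i k) ∧
      (∀ k ∈ I₁, ¬ (H δ₂).Adj i k) ∧ ∀ k ∈ I₂, ¬ (H δ₃).Adj i k := by
  simp [thirdLayer]

namespace IsNestedQuasiIndep

theorem mem_secondLayer_of_mem_second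
    (h : IsNestedQuasiIndep H δ₁ δ₂ δ₃ V I₁ I₂ I₃)
    {i : F} (hi : i ∈ I₂) : i ∈ secondLayer H δ₂ V I₁ :=
  h.second.prop.1 hi

theorem mem_thirdLayer_of_mem_third
    (h : IsNestedQuasiIndep H δ₁ δ₂ δ₃ V I₁ I₂ I₃)
    {i : F} (hi : i ∈ I₃) :
    i ∈ thirdLayer H δ₁ δ₂ δ₃ V I₁ I₂ :=
  h.third.prop.1 hi

theorem mem_secondLayer_of_mem_or
    (h : IsNestedQuasiIndep H δ₁ δ₂ δ₃ V I₁ I₂ I₃)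
    {i : F} (hi : i ∈ I₂ ∨ i ∈ I₃) : i ∈ secondLayer H δ₂ V I₁ :=
  hi.elim h.mem_secondLayer_of_mem_second fun hi =>
    (mem_thirdLayer.1 (h.mem_thirdLayer_of_mem_third hi)).1.1

theorem notMem_first_of_mem_or
    (h : IsNestedQuasiIndep H δ₁ δ₂ δ₃ V I₁ I₂ I₃)
    {i : F} (hi : i ∈ I₂ ∨ i ∈ I₃) : i ∉ I₁ :=
  (mem_secondLayer.1 (h.mem_secondLayer_of_mem_or hi)).1.2

theorem notMem_second_of_mem_third
    (h : IsNestedQuasiIndep H δ₁ δ₂ δ₃ V I₁ I₂ I₃)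
    {i : F} (hi : i ∈ I₃) : i ∉ I₂ :=
  (mem_thirdLayer.1 (h.mem_thirdLayer_of_mem_third hi)).1.2

theorem notMem_third_of_mem_second
    (h : IsNestedQuasiIndep H δ₁ δ₂ δ₃ V I₁ I₂ I₃)
    {i : F} (hi : i ∈ I₂) : i ∉ I₃ := fun hi' =>
  h.notMem_second_of_mem_third hi' hi

theorem not_adj_first
    (h : IsNestedQuasiIndep H δ₁ δ₂ δ₃ V I₁ I₂ I₃)
    {i k : F} (hi : i ∈ I₂ ∨ i ∈ I₃) (hk : k ∈ I₁) : ¬ (H δ₂).Adj i k :=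
  (mem_secondLayer.1 (h.mem_secondLayer_of_mem_or hi)).2 k hk

theorem centers_subset
    (h : IsNestedQuasiIndep H δ₁ δ₂ δ₃ V I₁ I₂ I₃)
    (heads marked : Finset F) :
    centers (H δ₁) I₁ I₂ I₃ heads marked ⊆ V := by
  intro i hi
  rcases mem_centers.1 hi with hi | hi | hi
  · exact h.first.prop.1 hi
  · exact (mem_secondLayer.1 (h.mem_secondLayer_of_mem_or (Or.inl hi.1))).1.1
  · exact (mem_secondLayer.1 (h.mem_secondLayer_of_mem_or (Or.inr hi.1))).1.1

/-- The parent `q(i)` of a point `i` of the third set. -/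
theorem exists_parent
    (h : IsNestedQuasiIndep H δ₁ δ₂ δ₃ V I₁ I₂ I₃)
    {i : F} (hi : i ∈ I₃) : ∃ q ∈ I₂, ∀ heads : Finset F,
    (∃ k ∈ I₂, (H δ₁).Adj i k ∧ k ∉ heads) ↔ q ∉ heads := by
  obtain ⟨q, ⟨hq, hadj⟩, huniq⟩ := (mem_thirdLayer.1 (h.mem_thirdLayer_of_mem_third hi)).2.1
  refine ⟨q, hq, fun heads => ⟨?_, fun hh => ⟨q, hq, hadj, hh⟩⟩⟩
  rintro ⟨k, hk, hik, hkh⟩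
  rwa [← huniq k ⟨hk, hik⟩]

open scoped Classical in
theorem indic_second
    (h : IsNestedQuasiIndep H δ₁ δ₂ δ₃ V I₁ I₂ I₃)
    {i : F} (hi : i ∈ I₂) (heads marked : Finset F) :
    indic i (centers (H δ₁) I₁ I₂ I₃ heads marked) =
      (if i ∈ heads then 1 else 0) * (if i ∈ marked then 1 else 0) := by
  have h1 := h.notMem_first_of_mem_or (Or.inl hi)
  have h3 := h.notMem_third_of_mem_second hi
  simp only [indic, mem_centers, h1, h3, hi, false_or, true_and, false_and, or_false, ite_and,
    mul_ite, mul_one, mul_zero]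
  split_ifs <;> rfl

open scoped Classical in
theorem exists_indic_third
    (h : IsNestedQuasiIndep H δ₁ δ₂ δ₃ V I₁ I₂ I₃)
    {i : F} (hi : i ∈ I₃) : ∃ q ∈ I₂, ∀ heads marked : Finset F,
    indic i (centers (H δ₁) I₁ I₂ I₃ heads marked) =
      (if q ∈ heads then 0 else 1) * (if i ∈ marked then 1 else 0) := by
  obtain ⟨q, hq, hq'⟩ := h.exists_parent hi
  refine ⟨q, hq, fun heads marked => ?_⟩
  have h1 := h.notMem_first_of_mem_or (Or.inr hi)
  have h2 := h.notMem_second_of_mem_third hi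
  simp only [indic, mem_centers, h1, h2, hi, false_or, true_and, false_and, hq', ite_and, mul_ite,
    mul_one, mul_zero]
  split_ifs <;> rfl

variable {p : ℝ}

theorem expect_indic_first {i : F} (hi : i ∈ I₁) :
    expect (H δ₁) p I₁ I₂ I₃ (indic i) = 1 := by
  classical
  have := expect_eq_of_event (G := H δ₁) (p := p) (I₁ := I₁) (I₂ := I₂) (I₃ := I₃)
    (f := indic i) (A := ∅) (B := ∅) (C := ∅) (by simp) (by simp) (by simp) (by simp)
    (fun heads _ marked => by simp [indic_of_mem (mem_centers.2 (Or.inl hi))])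
  simpa using this

theorem expect_indic_second
    (h : IsNestedQuasiIndep H δ₁ δ₂ δ₃ V I₁ I₂ I₃)
    {i : F} (hi : i ∈ I₂) :
    expect (H δ₁) p I₁ I₂ I₃ (indic i) = p := by
  classical
  rw [expect_eq_of_event (A := {i}) (B := ∅) (C := {i}) (by simpa using hi) (by simp) (by simp)
    (by simp [hi]) (fun heads _ marked => by simp [h.indic_second hi])]
  simp

theorem expect_indic_third
    (h : IsNestedQuasiIndep H δ₁ δ₂ δ₃ V I₁ I₂ I₃)
    {i : F} (hi : i ∈ I₃) :
    expect (H δ₁) p I₁ I₂ I₃ (indic i) = p := by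
  classical
  obtain ⟨q, hq, hi'⟩ := h.exists_indic_third hi
  rw [expect_eq_of_event (A := ∅) (B := {q}) (C := {i}) (by simp) (by simpa using hq) (by simp)
    (by simp [hi]) (fun heads _ marked => by simp [hi'])]
  simp

theorem expect_indic_of_mem_or
    (h : IsNestedQuasiIndep H δ₁ δ₂ δ₃ V I₁ I₂ I₃)
    {i : F} (hi : i ∈ I₂ ∨ i ∈ I₃) :
    expect (H δ₁) p I₁ I₂ I₃ (indic i) = p :=
  hi.elim h.expect_indic_second h.expect_indic_third

theorem expect_indic_of_notMem {i : F} (h1 : i ∉ I₁) (h2 : i ∉ I₂) (h3 : i ∉ I₃) :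
    expect (H δ₁) p I₁ I₂ I₃ (indic i) = 0 := by
  classical
  have : ∀ heads marked, indic i (centers (H δ₁) I₁ I₂ I₃ heads marked) = 0 := fun heads marked =>
    indic_of_notMem (by simp [mem_centers, h1, h2, h3])
  simp [expect, this]

/-- If `k ∈ I₃` has parent `i`, the coin of `i` excludes one of the two; in all other cases the two
points depend on different coins and trials. -/
theorem expect_indic_mul_le_of_mem_second
    (h : IsNestedQuasiIndep H δ₁ δ₂ δ₃ V I₁ I₂ I₃)
    {i k : F} (hi : i ∈ I₂) (hk : k ∈ I₂ ∨ k ∈ I₃)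
    (hik : i ≠ k) : expect (H δ₁) p I₁ I₂ I₃ (fun S => indic i S * indic k S) ≤ p ^ 2 := by
  classical
  rcases hk with hk | hk
  · rw [expect_eq_of_event (A := {i, k}) (B := ∅) (C := {i, k}) (by simp [Finset.insert_subset_iff,
      hi, hk]) (by simp) (by simp) (by simp [Finset.insert_subset_iff, hi, hk])
      (fun heads _ marked => ?_)]
    · rw [Finset.card_pair hik]
      simp only [Finset.card_empty, add_zero]
      exact le_of_eq (by ring)
    · simp only [h.indic_second hi, h.indic_second hk, Finset.insert_subset_iff,
        Finset.singleton_subset_iff, Finset.disjoint_empty_left, and_true]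
      by_cases i ∈ heads <;> by_cases i ∈ marked <;> by_cases k ∈ heads <;> by_cases k ∈ marked <;>
        simp [*]
  · obtain ⟨q, hq, hk'⟩ := h.exists_indic_third hk
    by_cases hqi : q = i
    · subst hqi
      have : ∀ heads marked, indic q (centers (H δ₁) I₁ I₂ I₃ heads marked) *
          indic k (centers (H δ₁) I₁ I₂ I₃ heads marked) = 0 := by
        intro heads marked
        rw [h.indic_second hi, hk']
        by_cases q ∈ heads <;> simp [*]
      simp only [expect, this, mul_zero, Finset.sum_const_zero]
      positivity
    · rw [expect_eq_of_event (A := {i}) (B := {q}) (C := {i, k}) (by simpa using hi)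
        (by simpa using hq) (by simpa using Ne.symm hqi)
        (by simp [Finset.insert_subset_iff, hi, hk]) (fun heads _ marked => ?_)]
      · rw [Finset.card_pair hik]
        simp only [Finset.card_singleton]
        exact le_of_eq (by ring)
      · simp only [h.indic_second hi, hk', Finset.insert_subset_iff,
          Finset.singleton_subset_iff, Finset.disjoint_singleton_left]
        by_cases i ∈ heads <;> by_cases i ∈ marked <;> by_cases q ∈ heads <;>
          by_cases k ∈ marked <;> simp [*]

/-- The worst case is two points of `I₃` with a common parent: they share one coin, which gives `(1
/ 2) * (2 * p) ^ 2`. -/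
theorem expect_indic_mul_le
    (h : IsNestedQuasiIndep H δ₁ δ₂ δ₃ V I₁ I₂ I₃)
    {i k : F} (hi : i ∈ I₂ ∨ i ∈ I₃) (hk : k ∈ I₂ ∨ k ∈ I₃)
    (hik : i ≠ k) : expect (H δ₁) p I₁ I₂ I₃ (fun S => indic i S * indic k S) ≤ 2 * p ^ 2 := by
  classical
  have hp := sq_nonneg p
  rcases hi with hi | hi
  · linarith [h.expect_indic_mul_le_of_mem_second (p := p) hi hk hik]
  rcases hk with hk | hk
  · have := h.expect_indic_mul_le_of_mem_second (p := p) hk (Or.inr hi) hik.symm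
    simp only [mul_comm (indic k _)] at this
    linarith
  obtain ⟨q, hq, hi'⟩ := h.exists_indic_third hi
  obtain ⟨r, hr, hk'⟩ := h.exists_indic_third hk
  rw [expect_eq_of_event (A := ∅) (B := {q, r}) (C := {i, k}) (by simp)
      (by simp [Finset.insert_subset_iff, hq, hr]) (by simp)
      (by simp [Finset.insert_subset_iff, hi, hk]) (fun heads _ marked => ?_)]
  · rw [Finset.card_pair hik]
    by_cases hqr : q = r
    · subst hqr
      simp only [Finset.pair_eq_singleton, Finset.card_singleton, Finset.card_empty]
      exact le_of_eq (by ring)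
    · rw [Finset.card_pair hqr]
      simp only [Finset.card_empty]
      linarith
  · simp only [hi', hk', Finset.insert_subset_iff, Finset.empty_subset, true_and,
      Finset.singleton_subset_iff, Finset.disjoint_singleton_left, Finset.disjoint_insert_left]
    by_cases q ∈ heads <;> by_cases i ∈ marked <;> by_cases r ∈ heads <;>
      by_cases k ∈ marked <;> simp [*]

theorem expect_sum_inter
    (h : IsNestedQuasiIndep H δ₁ δ₂ δ₃ V I₁ I₂ I₃)
    [DecidableEq F] (N : Finset F) (g : F → ℝ) :
    expect (H δ₁) p I₁ I₂ I₃ (fun S => ∑ i ∈ N ∩ S, g i) =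
      ∑ i ∈ N ∩ I₁, g i + p * (∑ i ∈ N ∩ I₂, g i + ∑ i ∈ N ∩ I₃, g i) := by
  have hS : ∀ S : Finset F, ∑ i ∈ N ∩ S, g i = ∑ i ∈ N, g i * (if i ∈ S then 1 else 0) := by
    intro S
    simp [← Finset.sum_ite_mem]
  have hS' : ∀ S : Finset F, ∑ i ∈ N ∩ S, g i = ∑ i ∈ N, g i * indic i S := by
    intro S
    rw [hS]
    refine Finset.sum_congr rfl fun i _ => ?_
    simp [indic]
  simp only [hS', expect_sum, expect_const_mul]
  simp only [← hS', hS, Finset.mul_sum, ← Finset.sum_add_distrib]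
  refine Finset.sum_congr rfl fun i _ => ?_
  by_cases h2 : i ∈ I₂
  · rw [h.expect_indic_second h2, if_neg (h.notMem_first_of_mem_or (Or.inl h2)), if_pos h2,
      if_neg (h.notMem_third_of_mem_second h2)]
    ring
  by_cases h3 : i ∈ I₃
  · rw [h.expect_indic_third h3, if_neg (h.notMem_first_of_mem_or (Or.inr h3)), if_pos h3,
      if_neg h2]
    ring
  by_cases h1 : i ∈ I₁
  · rw [expect_indic_first h1, if_pos h1, if_neg h2, if_neg h3]
    ring
  · rw [expect_indic_of_notMem h1 h2 h3, if_neg h1, if_neg h2, if_neg h3]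
    ring

end IsNestedQuasiIndep

end Layers

end EuclideanKMedian

namespace EuclideanKMedian

/-! ### The analysis of a single client -/

section Client

variable {d : ℕ} {F : Type} {z : F → Point d} {t : F → ℝ} {V N : Finset F} {w : F}
  {I₁ I₂ I₃ : Finset F} {p : ℝ} {C : Finset F → ℝ}

/-- The standing assumptions seen from one client, which is located at the origin and has
`α = 1`. -/
structure ClientView (z : F → Point d) (t : F → ℝ) (V N : Finset F) (w : F) : Prop where
  nbr_subset : N ⊆ V
  witness_mem : w ∈ V
  t_witness_le : t w ≤ 1
  norm_witness_le : ‖z w‖ ≤ 1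
  one_le_t : ∀ i ∈ N, 1 ≤ t i
  norm_lt_one : ∀ i ∈ N, ‖z i‖ < 1

open scoped Classical in
/-- The total depth `∑ (1 - ‖z i‖)` of the points of `N ∩ I`. -/
noncomputable def depth (z : F → Point d) (N I : Finset F) : ℝ := ∑ i ∈ N ∩ I, (1 - ‖z i‖)

theorem sqrt_two_lower : 1.41421 ≤ √2 := Real.le_sqrt' (by norm_num) |>.2 (by norm_num)

theorem sqrt_two_upper : √2 ≤ 1.41422 := Real.sqrt_le_left (by norm_num) |>.2 (by norm_num)

theorem conflictGraph_adj {δ : ℝ} {i k : F} :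
    (conflictGraph z t δ).Adj i k ↔ i ≠ k ∧ ‖z i - z k‖ ≤ δ * min (t i) (t k) := by
  rw [← dist_eq_norm]
  rfl

/-- On `N` the times are at least 1, so the relative separation in the graph becomes an absolute
one. -/
theorem ClientView.le_norm_sub (hv : ClientView z t V N w) {δ : ℝ} (hδ : 0 ≤ δ) {i k : F}
    (hi : i ∈ N) (hk : k ∈ N) (hik : i ≠ k) (hadj : ¬ (conflictGraph z t δ).Adj i k) :
    δ ≤ ‖z i - z k‖ := by
  rw [conflictGraph_adj, not_and, not_le] at hadj
  refine le_trans ?_ (hadj hik).le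
  exact le_mul_of_one_le_right hδ (le_min (hv.one_le_t i hi) (hv.one_le_t k hk))

theorem ClientView.two_le_norm_sub_sq (hv : ClientView z t V N w) {U I : Finset F}
    (hI : IsMaximalIndepIn (conflictGraph z t (√2)) U I) [DecidableEq F] :
    ∀ i ∈ N ∩ I, ∀ k ∈ N ∩ I, i ≠ k → 2 ≤ ‖z i - z k‖ ^ 2 := by
  intro i hi k hk hik
  rw [Finset.mem_inter] at hi hk
  have h := hv.le_norm_sub (Real.sqrt_nonneg 2) hi.1 hk.1 hik (hI.not_adj hi.2 hk.2)
  calc (2 : ℝ) = √2 ^ 2 := (Real.sq_sqrt (by norm_num)).symm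
    _ ≤ ‖z i - z k‖ ^ 2 := by gcongr

theorem ClientView.norm_le_one (hv : ClientView z t V N w) {I : Finset F} [DecidableEq F] :
    ∀ i ∈ N ∩ I, ‖z i‖ ≤ 1 := fun i hi => (hv.norm_lt_one i (Finset.mem_inter.1 hi).1).le

theorem ClientView.depth_le_one (hv : ClientView z t V N w) {U I : Finset F}
    (hI : IsMaximalIndepIn (conflictGraph z t (√2)) U I) : depth z N I ≤ 1 := by
  classical
  exact sum_one_sub_norm_le_one (hv.two_le_norm_sub_sq hI) hv.norm_le_one

open scoped Classical in
theorem ClientView.depth_le_of_card_ne_one (hv : ClientView z t V N w) {U I : Finset F}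
    (hI : IsMaximalIndepIn (conflictGraph z t (√2)) U I) (hcard : (N ∩ I).card ≠ 1) :
    depth z N I ≤ 2 - √2 := by
  rcases Nat.lt_or_ge (N ∩ I).card 2 with h | h
  · rw [depth, Finset.card_eq_zero.1 (show (N ∩ I).card = 0 by omega), Finset.sum_empty]
    linarith [sqrt_two_upper]
  · exact sum_one_sub_norm_le_of_two_le_card h (hv.two_le_norm_sub_sq hI) hv.norm_le_one

theorem le_norm_sub_of_mem_first
    (hv : ClientView z t V N w)
    (h : IsNestedQuasiIndep (conflictGraph z t) (√2) 1.395 (2 - √2) V I₁ I₂ I₃)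
    {i k : F} (hi : i ∈ N) (hi' : i ∈ I₂ ∨ i ∈ I₃) (hk : k ∈ N)
    (hk' : k ∈ I₁) : 1.395 ≤ ‖z i - z k‖ := by
  refine hv.le_norm_sub (by norm_num) hi hk ?_ (h.not_adj_first hi' hk')
  rintro rfl
  exact h.notMem_first_of_mem_or hi' hk'

/-- Only pairs with one point in each set need `δ₃`; within one set the separation is already `√2`.
-/
theorem two_sub_sqrt_two_le_norm_sub
    (hv : ClientView z t V N w)
    (h : IsNestedQuasiIndep (conflictGraph z t) (√2) 1.395 (2 - √2) V I₁ I₂ I₃)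
    {i k : F} (hi : i ∈ N) (hi' : i ∈ I₂ ∨ i ∈ I₃) (hk : k ∈ N)
    (hk' : k ∈ I₂ ∨ k ∈ I₃) (hik : i ≠ k) : 2 - √2 ≤ ‖z i - z k‖ := by
  have h1 := sqrt_two_lower
  have h2 := sqrt_two_upper
  have key : ∀ i ∈ N, i ∈ I₂ → ∀ k ∈ N, k ∈ I₃ → 2 - √2 ≤ ‖z k - z i‖ := by
    intro i hi hi' k hk hk'
    refine hv.le_norm_sub (by linarith) hk hi ?_
      ((mem_thirdLayer.1 (h.mem_thirdLayer_of_mem_third hk')).2.2.2 i hi')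
    rintro rfl
    exact h.notMem_second_of_mem_third hk' hi'
  rcases hi' with hi' | hi' <;> rcases hk' with hk' | hk'
  · have := hv.le_norm_sub (Real.sqrt_nonneg 2) hi hk hik (h.second.not_adj hi' hk')
    linarith
  · rw [norm_sub_rev]
    exact key i hi hi' k hk hk'
  · exact key k hk hk' i hi hi'
  · have := hv.le_norm_sub (Real.sqrt_nonneg 2) hi hk hik (h.third.not_adj hi' hk')
    linarith

theorem depth_le_of_exists_first
    (hv : ClientView z t V N w)
    (h : IsNestedQuasiIndep (conflictGraph z t) (√2) 1.395 (2 - √2) V I₁ I₂ I₃)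
    {k : F} (hk : k ∈ N) (hk' : k ∈ I₁) :
    depth z N I₂ ≤ 0.605 ∧ depth z N I₃ ≤ 0.605 := by
  classical
  have hk1 := hv.norm_lt_one k hk
  have key : ∀ i ∈ N, i ∈ I₂ ∨ i ∈ I₃ → 0.395 ≤ ‖z i‖ := by
    intro i hi hi'
    have := (le_norm_sub_of_mem_first hv h hi hi' hk hk').trans (norm_sub_le _ _)
    linarith
  constructor
  · refine sum_one_sub_norm_le_of_le_norm (hv.two_le_norm_sub_sq h.second) hv.norm_le_one
      fun i hi => ?_
    rw [Finset.mem_inter] at hi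
    exact key i hi.1 (Or.inl hi.2)
  · refine sum_one_sub_norm_le_of_le_norm (hv.two_le_norm_sub_sq h.third) hv.norm_le_one
      fun i hi => ?_
    rw [Finset.mem_inter] at hi
    exact key i hi.1 (Or.inr hi.2)

theorem depth_le_mul_norm_of_first
    (hv : ClientView z t V N w)
    (h : IsNestedQuasiIndep (conflictGraph z t) (√2) 1.395 (2 - √2) V I₁ I₂ I₃)
    {k : F} (hk : k ∈ N) (hk' : k ∈ I₁) :
    depth z N I₂ ≤ 1.2 * ‖z k‖ ∧ depth z N I₃ ≤ 1.2 * ‖z k‖ := by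
  classical
  constructor
  · refine sum_one_sub_norm_le_mul_norm (hv.two_le_norm_sub_sq h.second) hv.norm_le_one
      fun i hi => ?_
    rw [Finset.mem_inter] at hi
    exact le_norm_sub_of_mem_first hv h hi.1 (Or.inl hi.2) hk hk'
  · refine sum_one_sub_norm_le_mul_norm (hv.two_le_norm_sub_sq h.third) hv.norm_le_one
      fun i hi => ?_
    rw [Finset.mem_inter] at hi
    exact le_norm_sub_of_mem_first hv h hi.1 (Or.inr hi.2) hk hk'

/-- The point `w` is near to the first set, and if it is not `H(1.395)`-near then it belongs to
the second layer. -/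
theorem exists_first_near
    (hv : ClientView z t V N w)
    (hmax : IsMaximalIndepIn (conflictGraph z t (√2)) V I₁) :
    (∃ k ∈ I₁, ‖z k‖ ≤ 2.395) ∨ (w ∈ secondLayer (conflictGraph z t) 1.395 V I₁ ∧
      ∃ k ∈ I₁, (conflictGraph z t (√2)).Adj w k ∧ ‖z k‖ ≤ 1 + √2 * t w) := by
  have hw1 := hv.norm_witness_le
  have hw2 := hv.t_witness_le
  have hdist : ∀ δ, 0 ≤ δ → ∀ k, (conflictGraph z t δ).Adj w k → ‖z k‖ ≤ 1 + δ * t w := by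
    intro δ hδ k hk
    rw [conflictGraph_adj] at hk
    have h1 : ‖z k‖ ≤ ‖z w‖ + ‖z w - z k‖ := by
      rw [norm_sub_rev]
      exact norm_le_norm_add_norm_sub' _ _
    have h2 : δ * min (t w) (t k) ≤ δ * t w := by
      gcongr
      exact min_le_left _ _
    linarith [hk.2]
  by_cases hcase : ∃ k ∈ I₁, ‖z k‖ ≤ 2.395
  · exact Or.inl hcase
  · right
    push Not at hcase
    have hwI : w ∉ I₁ := fun hw => by linarith [hcase w hw]
    refine ⟨mem_secondLayer.2 ⟨⟨hv.witness_mem, hwI⟩, fun k hk hadj => ?_⟩, ?_⟩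
    · have := hdist 1.395 (by norm_num) k hadj
      linarith [hcase k hk]
    · obtain ⟨k, hk, rfl | hadj⟩ := hmax.exists_near hv.witness_mem
      · exact absurd hk hwI
      · exact ⟨k, hk, hadj, hdist _ (Real.sqrt_nonneg 2) k hadj⟩

theorem exists_first_norm_le
    (hv : ClientView z t V N w)
    (hmax : IsMaximalIndepIn (conflictGraph z t (√2)) V I₁) :
    ∃ k ∈ I₁, ‖z k‖ ≤ 2.41422 := by
  rcases exists_first_near hv hmax with ⟨k, hk, hz⟩ | ⟨-, k, hk, -, hz⟩
  · exact ⟨k, hk, by linarith⟩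
  · refine ⟨k, hk, hz.trans ?_⟩
    nlinarith [sqrt_two_upper, sqrt_two_lower, hv.t_witness_le]

/-- A point `u` of the second or third set near to `w` compensates for a first-set point `k` that
is near to `w` but far from the client. -/
theorem weighted_norm_le_of_near
    (hv : ClientView z t V N w)
    (h : IsNestedQuasiIndep (conflictGraph z t) (√2) 1.395 (2 - √2) V I₁ I₂ I₃)
    {k u : F} (hk : k ∈ I₁)
    (hwk : (conflictGraph z t (√2)).Adj w k) (hu : u ∈ I₂ ∨ u ∈ I₃)
    (hwu : u = w ∨ (conflictGraph z t (√2)).Adj w u) :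
    0.932 * ‖z k‖ + 0.068 * ‖z u‖ ≤ 2.395 := by
  have hw := hv.t_witness_le
  have hsq : √2 ^ 2 = 2 := Real.sq_sqrt (by norm_num)
  have hs0 := Real.sqrt_nonneg 2
  have hnear : ∀ i, (conflictGraph z t (√2)).Adj w i →
      0 ≤ t i ∧ ‖z i - z w‖ ^ 2 ≤ 2 ∧ ‖z i - z w‖ ^ 2 ≤ 2 * t i ^ 2 := by
    intro i hi
    rw [conflictGraph_adj, norm_sub_rev] at hi
    have h0 : 0 ≤ min (t w) (t i) := by
      by_contra! hneg
      have h1 := norm_nonneg (z i - z w)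
      have h2 : √2 * min (t w) (t i) < 0 :=
        mul_neg_of_pos_of_neg (by positivity) hneg
      linarith [hi.2]
    have h1 : ‖z i - z w‖ ^ 2 ≤ (√2 * min (t w) (t i)) ^ 2 := by
      gcongr
      exact hi.2
    rw [mul_pow, hsq] at h1
    have h2 : min (t w) (t i) ^ 2 ≤ 1 := pow_le_one₀ h0 ((min_le_left _ _).trans hw)
    have h3 : min (t w) (t i) ^ 2 ≤ t i ^ 2 := by
      gcongr
      exact min_le_right _ _
    exact ⟨h0.trans (min_le_right _ _), by linarith, by linarith⟩
  obtain ⟨hk0, hk1, hk2⟩ := hnear k hwk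
  -- Here `e = z w`, `a = z k - z w`, and `b` is the offset from `w` to `u`, which is zero if `u =
  -- w`.
  have hfin : ∀ b : Point d, ‖b‖ ^ 2 ≤ 2 →
      1.395 ^ 2 / 2 * min (‖z k - z w‖ ^ 2) (‖b‖ ^ 2) ≤ ‖z k - z w - b‖ ^ 2 →
      0.932 * ‖z k‖ + 0.068 * ‖z w + b‖ ≤ 2.395 := by
    intro b hb hab
    have := weighted_norm_add_le hv.norm_witness_le hk1 hb hab
    rwa [add_sub_cancel] at this
  rcases hwu with rfl | hwu
  · have := hfin 0 (by simp) (by simp)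
    simpa using this
  · obtain ⟨hu0, hu1, hu2⟩ := hnear u hwu
    have hne : u ≠ k := by
      rintro rfl
      exact h.notMem_first_of_mem_or hu hk
    have hsep := h.not_adj_first hu hk
    rw [conflictGraph_adj, not_and, not_le] at hsep
    have hsep := hsep hne
    have hm0 : 0 ≤ min (t u) (t k) := le_min hu0 hk0
    have hsep2 : (1.395 * min (t u) (t k)) ^ 2 ≤ ‖z u - z k‖ ^ 2 := by gcongr
    have hb := hfin (z u - z w) hu1 ?_
    · rwa [add_sub_cancel] at hb
    · rw [sub_sub_sub_cancel_right, norm_sub_rev (z k) (z u)]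
      refine le_trans ?_ hsep2
      rcases le_total (t u) (t k) with hle | hle
      · rw [min_eq_left hle]
        linarith [min_le_right (‖z k - z w‖ ^ 2) (‖z u - z w‖ ^ 2)]
      · rw [min_eq_right hle]
        linarith [min_le_left (‖z k - z w‖ ^ 2) (‖z u - z w‖ ^ 2)]

/-- If a point `v` of `N` in the second or third set is very close to the client, then there is
another point of these sets that is near to `w`, and it is nearly independent of `v`. -/
theorem exists_second_near
    (hv : ClientView z t V N w)
    (h : IsNestedQuasiIndep (conflictGraph z t) (√2) 1.395 (2 - √2) V I₁ I₂ I₃)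
    {k v : F} (hw : w ∈ secondLayer (conflictGraph z t) 1.395 V I₁)
    (hk : 2.395 < ‖z k‖) (hk1 : ‖z k‖ ≤ 1 + √2 * t w) (hwk : (conflictGraph z t (√2)).Adj w k)
    (hvN : v ∈ N) (hvI : v ∈ I₂ ∨ v ∈ I₃) (hv1 : ‖z v‖ < 0.19) (p : ℝ) :
    ∃ u, (u ∈ I₂ ∨ u ∈ I₃) ∧ (u = w ∨ (conflictGraph z t (√2)).Adj w u) ∧
      expect (conflictGraph z t (√2)) p I₁ I₂ I₃ (fun S => indic v S * indic u S) ≤ p ^ 2 := by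
  have h1 := sqrt_two_lower
  have h2 := sqrt_two_upper
  have htw := hv.t_witness_le
  have hzw := hv.norm_witness_le
  have htv := hv.one_le_t v hvN
  rcases hvI with hvI | hvI
  -- A point `k` beyond 2.395 but within `√2` of `w` forces `w` close to the unit sphere.
  · have hzw' : 0.98 ≤ ‖z w‖ := by
      rw [conflictGraph_adj] at hwk
      have h3 : ‖z k‖ ≤ ‖z w‖ + ‖z w - z k‖ := by
        rw [norm_sub_rev]
        exact norm_le_norm_add_norm_sub' _ _
      have h4 : √2 * min (t w) (t k) ≤ √2 * 1 := by
        gcongr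
        exact (min_le_left _ _).trans htw
      linarith [hwk.2]
    have hvw : v ≠ w := by
      rintro rfl
      linarith
    -- The distance is at most `1 + 0.19`, while `√2 * t w > 1.395` because `2.395 < ‖z k‖ ≤ 1 + √2
    -- * t w`.
    have hwv : (conflictGraph z t (√2)).Adj w v := by
      rw [conflictGraph_adj]
      refine ⟨hvw.symm, (norm_sub_le _ _).trans ?_⟩
      rw [min_eq_left (htw.trans htv)]
      linarith
    have hwI : w ∉ I₂ := fun hwI => h.second.not_adj hwI hvI hwv
    by_cases hex : ∃ u ∈ I₂, u ≠ v ∧ (conflictGraph z t (√2)).Adj w u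
    · obtain ⟨u, hu, huv, hwu⟩ := hex
      exact ⟨u, Or.inl hu, Or.inr hwu,
        h.expect_indic_mul_le_of_mem_second hvI (Or.inl hu) huv.symm⟩
    -- Now `v` is the only neighbour of `w` in `I₂`, so `w` qualifies for the third layer and `I₃`
    -- has a point near it.
    · push Not at hex
      have hthird : w ∈ thirdLayer (conflictGraph z t) (√2) 1.395 (2 - √2) V I₁ I₂ := by
        refine mem_thirdLayer.2 ⟨⟨hw, hwI⟩, ⟨v, ⟨hvI, hwv⟩, fun u hu => ?_⟩,
          (mem_secondLayer.1 hw).2, fun u hu hadj => ?_⟩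
        · by_contra hne
          exact hex u hu.1 hne hu.2
        -- An `H(2 - √2)`-neighbour of `w` in `I₂` is also an `H(√2)`-neighbour, hence is `v`; but
        -- `v` is at distance at least `0.98 - 0.19` from `w`.
        · rw [conflictGraph_adj] at hadj
          have hmin : 0 ≤ min (t w) (t u) := by
            by_contra! hneg
            have := norm_nonneg (z w - z u)
            nlinarith [hadj.2]
          have huv : u = v := by
            by_contra hne
            refine hex u hu hne (conflictGraph_adj.2 ⟨hadj.1, hadj.2.trans ?_⟩)
            gcongr
            linarith
          subst huv
          have h3 : ‖z w‖ ≤ ‖z u‖ + ‖z w - z u‖ := norm_le_norm_add_norm_sub' _ _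
          have h4 : (2 - √2) * min (t w) (t u) ≤ (2 - √2) * 1 := by
            gcongr
            · linarith
            · exact (min_le_left _ _).trans htw
          linarith [hadj.2]
      obtain ⟨u, hu, hwu⟩ := h.third.exists_near hthird
      refine ⟨u, Or.inr hu, hwu, h.expect_indic_mul_le_of_mem_second hvI (Or.inr hu) ?_⟩
      rintro rfl
      exact h.notMem_third_of_mem_second hvI hu
  · obtain ⟨u, hu, hwu⟩ := h.second.exists_near hw
    refine ⟨u, Or.inl hu, hwu, ?_⟩
    simp only [mul_comm (indic v _)]
    refine h.expect_indic_mul_le_of_mem_second hu (Or.inr hvI) ?_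
    rintro rfl
    exact h.notMem_second_of_mem_third hvI hu

end Client

end EuclideanKMedian

namespace EuclideanKMedian

/-! ### The expected cost of a single client -/

section ClientExpectation

variable {d : ℕ} {F : Type} {z : F → Point d} {t : F → ℝ} {V N : Finset F} {w : F}
  {I₁ I₂ I₃ : Finset F} {p : ℝ} {C : Finset F → ℝ} {H : ℝ → SimpleGraph F} {δ₁ δ₂ δ₃ R : ℝ}

theorem expect_le_of_first {G : SimpleGraph F} (hp0 : 0 ≤ p) (hp1 : 2 * p ≤ 1)
    (hC : ∀ S, ∀ i ∈ S, C S ≤ ‖z i‖) {k : F} (hk : k ∈ I₁) :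
    expect G p I₁ I₂ I₃ C ≤ ‖z k‖ := by
  rw [← expect_const (G := G) (p := p) (I₁ := I₁) (I₂ := I₂) (I₃ := I₃) ‖z k‖]
  exact expect_mono hp0 hp1 fun _ _ _ => hC _ k (mem_centers.2 (Or.inl hk))

theorem expect_le_of_mem
    (h : IsNestedQuasiIndep H δ₁ δ₂ δ₃ V I₁ I₂ I₃) (hp0 : 0 ≤ p) (hp1 : 2 * p ≤ 1)
    (hC : ∀ S, ∀ i ∈ S, C S ≤ ‖z i‖) (hR : ∃ k ∈ I₁, ‖z k‖ ≤ R)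
    {v : F} (hv : v ∈ I₂ ∨ v ∈ I₃) :
    expect (H δ₁) p I₁ I₂ I₃ C ≤ R - p * (R - ‖z v‖) := by
  obtain ⟨k, hk, hkR⟩ := hR
  have h1 : expect (H δ₁) p I₁ I₂ I₃ (fun S => R - (R - ‖z v‖) * indic v S) =
      R - p * (R - ‖z v‖) := by
    rw [expect_sub, expect_const, expect_const_mul, h.expect_indic_of_mem_or hv]
    ring
  rw [← h1]
  refine expect_mono hp0 hp1 fun heads _ marked => ?_
  set S := centers (H δ₁) I₁ I₂ I₃ heads marked
  have hk' : C S ≤ R := (hC S k (mem_centers.2 (Or.inl hk))).trans hkR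
  by_cases hvS : v ∈ S
  · rw [indic_of_mem hvS]
    linarith [hC S v hvS]
  · rw [indic_of_notMem hvS]
    linarith

/-- Pointwise, `C` is at most `R` minus the credit `R - ‖z v‖` if `v` is open, minus `g` if `u` is
open, with `g` given back if both are. The credit `g` may be chosen below `R - ‖z u‖`. -/
theorem expect_le_of_pair
    (h : IsNestedQuasiIndep H δ₁ δ₂ δ₃ V I₁ I₂ I₃) (hp0 : 0 ≤ p) (hp1 : 2 * p ≤ 1)
    (hC : ∀ S, ∀ i ∈ S, C S ≤ ‖z i‖) (hR : ∃ k ∈ I₁, ‖z k‖ ≤ R)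
    {v u : F} (hv : v ∈ I₂ ∨ v ∈ I₃) (hu : u ∈ I₂ ∨ u ∈ I₃) {g q : ℝ}
    (hg0 : 0 ≤ g) (hg : g ≤ R - ‖z u‖)
    (hq : expect (H δ₁) p I₁ I₂ I₃ (fun S => indic v S * indic u S) ≤ q) :
    expect (H δ₁) p I₁ I₂ I₃ C ≤ R - p * (R - ‖z v‖) - p * g + g * q := by
  obtain ⟨k, hk, hkR⟩ := hR
  have h1 : expect (H δ₁) p I₁ I₂ I₃ (fun S => R - (R - ‖z v‖) * indic v S - g * indic u S +
      g * (indic v S * indic u S)) ≤ R - p * (R - ‖z v‖) - p * g + g * q := by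
    rw [expect_add, expect_sub, expect_sub, expect_const, expect_const_mul, expect_const_mul,
      expect_const_mul, h.expect_indic_of_mem_or hv, h.expect_indic_of_mem_or hu]
    linarith [mul_le_mul_of_nonneg_left hq hg0]
  refine le_trans (expect_mono hp0 hp1 fun heads _ marked => ?_) h1
  set S := centers (H δ₁) I₁ I₂ I₃ heads marked
  have hk' : C S ≤ R := (hC S k (mem_centers.2 (Or.inl hk))).trans hkR
  by_cases hvS : v ∈ S <;> by_cases huS : u ∈ S
  · rw [indic_of_mem hvS, indic_of_mem huS]
    linarith [hC S v hvS]
  · rw [indic_of_mem hvS, indic_of_notMem huS]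
    linarith [hC S v hvS]
  · rw [indic_of_notMem hvS, indic_of_mem huS]
    linarith [hC S u huS]
  · rw [indic_of_notMem hvS, indic_of_notMem huS]
    linarith

/-- A Bonferroni bound: when several of the three points are open, the pair terms return at least
the surplus credit. Each of the three pairs has probability at most `2 * p ^ 2`. -/
theorem expect_le_of_triple
    (h : IsNestedQuasiIndep H δ₁ δ₂ δ₃ V I₁ I₂ I₃) (hp0 : 0 ≤ p) (hp1 : 2 * p ≤ 1)
    (hC : ∀ S, ∀ i ∈ S, C S ≤ ‖z i‖) (hR : ∃ k ∈ I₁, ‖z k‖ ≤ R)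
    {v a b : F} (hv : v ∈ I₂ ∨ v ∈ I₃) (ha : a ∈ I₂ ∨ a ∈ I₃)
    (hb : b ∈ I₂ ∨ b ∈ I₃) (hva : v ≠ a) (hvb : v ≠ b) (hab : a ≠ b) (hR1 : 1 ≤ R)
    (ha1 : ‖z a‖ ≤ 1) (hb1 : ‖z b‖ ≤ 1) :
    expect (H δ₁) p I₁ I₂ I₃ C ≤
      R - p * (R - ‖z v‖) - 2 * p * (R - 1) + 6 * p ^ 2 * (R - 1) := by
  obtain ⟨k, hk, hkR⟩ := hR
  have h1 : expect (H δ₁) p I₁ I₂ I₃ (fun S => R - (R - ‖z v‖) * indic v S -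
      (R - 1) * (indic a S + indic b S) + (R - 1) * (indic v S * indic a S +
        indic v S * indic b S + indic a S * indic b S)) ≤
      R - p * (R - ‖z v‖) - 2 * p * (R - 1) + 6 * p ^ 2 * (R - 1) := by
    rw [expect_add, expect_sub, expect_sub, expect_const, expect_const_mul, expect_const_mul,
      expect_const_mul, expect_add, expect_add, expect_add, h.expect_indic_of_mem_or hv,
      h.expect_indic_of_mem_or ha, h.expect_indic_of_mem_or hb]
    have e1 := h.expect_indic_mul_le (p := p) hv ha hva
    have e2 := h.expect_indic_mul_le (p := p) hv hb hvb
    have e3 := h.expect_indic_mul_le (p := p) ha hb hab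
    have e := mul_le_mul_of_nonneg_left (add_le_add (add_le_add e1 e2) e3) (sub_nonneg.2 hR1)
    linarith
  refine le_trans (expect_mono hp0 hp1 fun heads _ marked => ?_) h1
  set S := centers (H δ₁) I₁ I₂ I₃ heads marked
  have hk' : C S ≤ R := (hC S k (mem_centers.2 (Or.inl hk))).trans hkR
  have key : ∀ i : F, indic i S = 0 ∨ indic i S = 1 ∧ C S ≤ ‖z i‖ := fun i => by
    by_cases hi : i ∈ S
    · exact Or.inr ⟨indic_of_mem hi, hC S i hi⟩
    · exact Or.inl (indic_of_notMem hi)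
  rcases key v with e1 | ⟨e1, f1⟩ <;> rcases key a with e2 | ⟨e2, f2⟩ <;>
    rcases key b with e3 | ⟨e3, f3⟩ <;> rw [e1, e2, e3] <;> linarith

theorem expect_one_sub_sum
    (h : IsNestedQuasiIndep (conflictGraph z t) (√2) 1.395 (2 - √2) V I₁ I₂ I₃)
    [DecidableEq F] :
    expect (conflictGraph z t (√2)) p I₁ I₂ I₃ (fun S => 1 - ∑ i ∈ N ∩ S, (1 - ‖z i‖)) =
      1 - depth z N I₁ - p * (depth z N I₂ + depth z N I₃) := by
  rw [expect_sub, expect_const, h.expect_sum_inter]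
  simp only [depth]
  have : (fun a b : F => Classical.propDecidable (a = b)) = ‹DecidableEq F› :=
    Subsingleton.elim _ _
  rw [this]
  ring

open scoped Classical in
/-- Three points that are deep enough to pay for the whole neighbourhood of the client. -/
theorem exists_three_of_card
    (hv : ClientView z t V N w)
    (h : IsNestedQuasiIndep (conflictGraph z t) (√2) 1.395 (2 - √2) V I₁ I₂ I₃)
    (hcard : 3 ≤ (N ∩ I₂).card + (N ∩ I₃).card) : ∃ v a b,
    (v ∈ N ∧ a ∈ N ∧ b ∈ N) ∧ (v ∈ I₂ ∨ v ∈ I₃) ∧ (a ∈ I₂ ∨ a ∈ I₃) ∧ (b ∈ I₂ ∨ b ∈ I₃) ∧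
      v ≠ a ∧ v ≠ b ∧ a ≠ b ∧
      (depth z N I₂ + depth z N I₃ ≤ (1 - ‖z v‖) + (2 - √2) ∨
        depth z N I₂ + depth z N I₃ ≤ (2 - √2) + (2 - √2)) := by
  have hdisj : Disjoint (N ∩ I₂) (N ∩ I₃) := by
    rw [Finset.disjoint_left]
    intro i hi hi'
    exact h.notMem_third_of_mem_second (Finset.mem_inter.1 hi).2 (Finset.mem_inter.1 hi').2
  by_cases h2 : (N ∩ I₂).card = 1
  · obtain ⟨v, hv2⟩ := Finset.card_eq_one.1 h2
    obtain ⟨a, ha, b, hb, hab⟩ := Finset.one_lt_card.1 (show 1 < (N ∩ I₃).card by omega)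
    have hvm : v ∈ N ∩ I₂ := hv2 ▸ Finset.mem_singleton_self v
    have hva : v ≠ a := fun e => Finset.disjoint_left.1 hdisj hvm (e ▸ ha)
    have hvb : v ≠ b := fun e => Finset.disjoint_left.1 hdisj hvm (e ▸ hb)
    have hd := hv.depth_le_of_card_ne_one h.third (by omega)
    rw [Finset.mem_inter] at hvm ha hb
    refine ⟨v, a, b, ⟨hvm.1, ha.1, hb.1⟩, Or.inl hvm.2, Or.inr ha.2, Or.inr hb.2, hva, hvb, hab,
      Or.inl ?_⟩
    have : depth z N I₂ = 1 - ‖z v‖ := by rw [depth, hv2, Finset.sum_singleton]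
    linarith
  by_cases h3 : (N ∩ I₃).card = 1
  · obtain ⟨v, hv3⟩ := Finset.card_eq_one.1 h3
    obtain ⟨a, ha, b, hb, hab⟩ := Finset.one_lt_card.1 (show 1 < (N ∩ I₂).card by omega)
    have hvm : v ∈ N ∩ I₃ := hv3 ▸ Finset.mem_singleton_self v
    have hva : v ≠ a := fun e => Finset.disjoint_right.1 hdisj hvm (e ▸ ha)
    have hvb : v ≠ b := fun e => Finset.disjoint_right.1 hdisj hvm (e ▸ hb)
    have hd := hv.depth_le_of_card_ne_one h.second (by omega)
    rw [Finset.mem_inter] at hvm ha hb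
    refine ⟨v, a, b, ⟨hvm.1, ha.1, hb.1⟩, Or.inr hvm.2, Or.inl ha.2, Or.inl hb.2, hva, hvb, hab,
      Or.inl ?_⟩
    have : depth z N I₃ = 1 - ‖z v‖ := by rw [depth, hv3, Finset.sum_singleton]
    linarith
  -- Neither set has exactly one point of `N`, so both depths are at most `2 - √2` and any three
  -- points serve.
  · have hc : 2 < (N ∩ I₂ ∪ N ∩ I₃).card := by
      rw [Finset.card_union_of_disjoint hdisj]
      omega
    obtain ⟨v, a, b, hvm, ha, hb, hva, hvb, hab⟩ := Finset.two_lt_card_iff.1 hc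
    rw [← Finset.inter_union_distrib_left, Finset.mem_inter, Finset.mem_union] at hvm ha hb
    exact ⟨v, a, b, ⟨hvm.1, ha.1, hb.1⟩, hvm.2, ha.2, hb.2, hva, hvb, hab, Or.inr
      (add_le_add (hv.depth_le_of_card_ne_one h.second h2)
        (hv.depth_le_of_card_ne_one h.third h3))⟩

/-- The per-client inequality for a client with a neighbour in the first set. -/
theorem expect_le_of_exists_first
    (hv : ClientView z t V N w)
    (h : IsNestedQuasiIndep (conflictGraph z t) (√2) 1.395 (2 - √2) V I₁ I₂ I₃)
    (hC : ∀ S, ∀ i ∈ S, C S ≤ ‖z i‖)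
    {k : F} (hk : k ∈ N) (hk' : k ∈ I₁) (hp0 : 0 ≤ p)
    (hp1 : p < 0.337) :
    expect (conflictGraph z t (√2)) p I₁ I₂ I₃ C ≤
        200 * (1 - depth z N I₁ - p * (depth z N I₂ + depth z N I₃)) ∧
      (p = 0.068 → expect (conflictGraph z t (√2)) p I₁ I₂ I₃ C ≤
        2.395 * (1 - depth z N I₁ - p * (depth z N I₂ + depth z N I₃))) := by
  classical
  have h1 := sqrt_two_lower
  have h2 := sqrt_two_upper
  obtain ⟨k, hk, hmin⟩ := (N ∩ I₁).exists_min_image (fun i => ‖z i‖)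
    ⟨k, Finset.mem_inter.2 ⟨hk, hk'⟩⟩
  have hkm := Finset.mem_inter.1 hk
  have hnum := expect_le_of_first (G := conflictGraph z t (√2)) (I₂ := I₂) (I₃ := I₃) hp0
    (by linarith) hC hkm.2
  have hk0 := norm_nonneg (z k)
  have hk1 := hv.norm_lt_one k hkm.1
  by_cases hone : (N ∩ I₁).card = 1
  · obtain ⟨k', hk'⟩ := Finset.card_eq_one.1 hone
    have hkk : k = k' := by
      rw [hk'] at hk
      exact Finset.mem_singleton.1 hk
    have hd1 : depth z N I₁ = 1 - ‖z k‖ := by rw [depth, hk', Finset.sum_singleton, hkk]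
    obtain ⟨hd2, hd3⟩ := depth_le_mul_norm_of_first hv h hkm.1 hkm.2
    have hd : p * (depth z N I₂ + depth z N I₃) ≤ p * (2.4 * ‖z k‖) := by
      gcongr
      linarith
    rw [hd1]
    constructor
    · have : p * (2.4 * ‖z k‖) ≤ 0.337 * (2.4 * ‖z k‖) := by gcongr
      linarith
    · rintro rfl
      linarith
  -- This case determines the factor 200: `√2 - 1 - 1.21 * p` stays above `1 / 200` for `p < 0.337`.
  · have hd1 := hv.depth_le_of_card_ne_one h.first hone
    obtain ⟨hd2, hd3⟩ := depth_le_of_exists_first hv h hkm.1 hkm.2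
    have hd : p * (depth z N I₂ + depth z N I₃) ≤ p * 1.21 := by
      gcongr
      linarith
    constructor
    · linarith
    · rintro rfl
      rcases le_total ‖z k‖ 0.75 with hm | hm
      · linarith
      -- For a norm near 1 the bound `2 - √2` is too weak, but then all points of `N ∩ I₁` are far
      -- out and the depth is at most `1 / (1 + ‖z k‖)`.
      · have hd1' : (1 + ‖z k‖) * depth z N I₁ ≤ 1 :=
          sum_one_sub_norm_le_inv (hv.two_le_norm_sub_sq h.first) hmin hv.norm_le_one
        have hmul : (1 + ‖z k‖) * ‖z k‖ ≤
            (1 + ‖z k‖) * (2.395 * (1 - depth z N I₁ - 0.068 * 1.21)) := by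
          nlinarith [mul_nonneg (sub_nonneg.2 hm) (sub_nonneg.2 hk1.le)]
        have := le_of_mul_le_mul_left hmul (by linarith)
        linarith

/-- The per-client inequality, up to a constant factor. -/
theorem expect_le_of_lt
    (hv : ClientView z t V N w)
    (h : IsNestedQuasiIndep (conflictGraph z t) (√2) 1.395 (2 - √2) V I₁ I₂ I₃)
    (hC : ∀ S, ∀ i ∈ S, C S ≤ ‖z i‖)
    (hp0 : 0 ≤ p) (hp1 : p < 0.337) :
    expect (conflictGraph z t (√2)) p I₁ I₂ I₃ C ≤
      200 * (1 - depth z N I₁ - p * (depth z N I₂ + depth z N I₃)) := by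
  classical
  rcases (N ∩ I₁).eq_empty_or_nonempty with hemp | ⟨k, hk⟩
  · have hd1 : depth z N I₁ = 0 := by rw [depth, hemp, Finset.sum_empty]
    have hd2 := hv.depth_le_one h.second
    have hd3 := hv.depth_le_one h.third
    have hd : p * (depth z N I₂ + depth z N I₃) ≤ p * 2 := by
      gcongr
      linarith
    obtain ⟨k, hk, hkR⟩ := exists_first_norm_le hv h.first
    have := expect_le_of_first (G := conflictGraph z t (√2)) (I₂ := I₂) (I₃ := I₃) hp0
      (by linarith) hC hk
    rw [hd1]
    linarith
  · rw [Finset.mem_inter] at hk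
    exact (expect_le_of_exists_first hv h hC hk.1 hk.2 hp0 hp1).1

open scoped Classical in
theorem expect_le_of_card_eq_zero
    (hv : ClientView z t V N w)
    (h : IsNestedQuasiIndep (conflictGraph z t) (√2) 1.395 (2 - √2) V I₁ I₂ I₃)
    (hC : ∀ S, ∀ i ∈ S, C S ≤ ‖z i‖)
    (hcard : (N ∩ I₂).card + (N ∩ I₃).card = 0) :
    expect (conflictGraph z t (√2)) 0.068 I₁ I₂ I₃ C ≤
      2.395 * (1 - 0.068 * (depth z N I₂ + depth z N I₃)) := by
  have hd2 : depth z N I₂ = 0 := by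
    rw [depth, Finset.card_eq_zero.1 (show (N ∩ I₂).card = 0 by omega), Finset.sum_empty]
  have hd3 : depth z N I₃ = 0 := by
    rw [depth, Finset.card_eq_zero.1 (show (N ∩ I₃).card = 0 by omega), Finset.sum_empty]
  rw [hd2, hd3]
  rcases exists_first_near hv h.first with ⟨k, hk, hz⟩ | ⟨hw, k, hk, hwk, hz⟩
  · have := expect_le_of_first (G := conflictGraph z t (√2)) (p := 0.068) (I₂ := I₂) (I₃ := I₃)
      (by norm_num) (by norm_num) hC hk
    linarith
  · obtain ⟨u, hu, hwu⟩ := h.second.exists_near hw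
    have h1 := weighted_norm_le_of_near hv h hk hwk (Or.inl hu) hwu
    have h2 := expect_le_of_mem (p := 0.068) h (by norm_num) (by norm_num) hC ⟨k, hk, le_rfl⟩
      (Or.inl hu)
    linarith

theorem expect_le_of_single
    (hv : ClientView z t V N w)
    (h : IsNestedQuasiIndep (conflictGraph z t) (√2) 1.395 (2 - √2) V I₁ I₂ I₃)
    (hC : ∀ S, ∀ i ∈ S, C S ≤ ‖z i‖)
    {v : F} (hvN : v ∈ N) (hvI : v ∈ I₂ ∨ v ∈ I₃) :
    expect (conflictGraph z t (√2)) 0.068 I₁ I₂ I₃ C ≤ 2.395 * (1 - 0.068 * (1 - ‖z v‖)) := by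
  have hv0 := norm_nonneg (z v)
  have hsmall : (∃ k ∈ I₁, ‖z k‖ ≤ 2.395) → expect (conflictGraph z t (√2)) 0.068 I₁ I₂ I₃ C ≤
      2.395 * (1 - 0.068 * (1 - ‖z v‖)) := by
    intro hR
    have := expect_le_of_mem (p := 0.068) h (by norm_num) (by norm_num) hC hR hvI
    linarith
  rcases exists_first_near hv h.first with hR | ⟨hw, k, hk, hwk, hz⟩
  · exact hsmall hR
  rcases le_or_gt ‖z k‖ 2.395 with hkR | hkR
  · exact hsmall ⟨k, hk, hkR⟩
  -- From 0.19 on, the slack `0.068 * 1.395 * ‖z v‖` covers the loss `0.932 * (2.41422 - 2.395)`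
  -- caused by the crude radius.
  rcases lt_or_ge ‖z v‖ 0.19 with hlt | hge
  · obtain ⟨u, hu, hwu, hq⟩ := exists_second_near hv h hw hkR hz hwk hvN hvI hlt 0.068
    have h1 := weighted_norm_le_of_near hv h hk hwk hu hwu
    -- With `R = ‖z k‖`, this `g` makes `0.068 * g` the excess of `R` over 2.395, so the outcome is
    -- the same as for radius 2.395. The condition on `g` is exactly `h1`.
    have h2 := expect_le_of_pair (p := 0.068) h (by norm_num) (by norm_num) hC ⟨k, hk, le_rfl⟩
      hvI hu (g := (‖z k‖ - 2.395) / 0.068) (div_nonneg (by linarith) (by norm_num))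
      (by rw [div_le_iff₀ (by norm_num)]; linarith) hq
    have e1 : 0.068 * ((‖z k‖ - 2.395) / 0.068) = ‖z k‖ - 2.395 := by ring
    have e2 : (‖z k‖ - 2.395) / 0.068 * 0.068 ^ 2 = 0.068 * (‖z k‖ - 2.395) := by ring
    rw [e1, e2] at h2
    linarith
  · have := expect_le_of_mem (p := 0.068) h (by norm_num) (by norm_num) hC
      (exists_first_norm_le hv h.first) hvI
    linarith

/-- As the norms add up to at least `2 - √2`, the slack `0.068 * 1.395 * (‖z v‖ + ‖z u‖)` covers
both the crude radius and a joint probability of `2 * p ^ 2`. -/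
theorem expect_le_of_two
    (hv : ClientView z t V N w)
    (h : IsNestedQuasiIndep (conflictGraph z t) (√2) 1.395 (2 - √2) V I₁ I₂ I₃)
    (hC : ∀ S, ∀ i ∈ S, C S ≤ ‖z i‖)
    {v u : F} (hvN : v ∈ N) (hvI : v ∈ I₂ ∨ v ∈ I₃) (huN : u ∈ N)
    (huI : u ∈ I₂ ∨ u ∈ I₃) (hvu : v ≠ u) :
    expect (conflictGraph z t (√2)) 0.068 I₁ I₂ I₃ C ≤
      2.395 * (1 - 0.068 * ((1 - ‖z v‖) + (1 - ‖z u‖))) := by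
  have hsum := (two_sub_sqrt_two_le_norm_sub hv h hvN hvI huN huI hvu).trans (norm_sub_le _ _)
  have h2 := sqrt_two_upper
  have hu1 := hv.norm_lt_one u huN
  have hu0 := norm_nonneg (z u)
  have := expect_le_of_pair (p := 0.068) h (by norm_num) (by norm_num) hC
    (exists_first_norm_le hv h.first) hvI huI (g := 2.41422 - ‖z u‖) (by linarith) le_rfl
    (h.expect_indic_mul_le hvI huI hvu)
  linarith

open scoped Classical in
theorem expect_le_of_three_le_card
    (hv : ClientView z t V N w)
    (h : IsNestedQuasiIndep (conflictGraph z t) (√2) 1.395 (2 - √2) V I₁ I₂ I₃)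
    (hC : ∀ S, ∀ i ∈ S, C S ≤ ‖z i‖)
    (hcard : 3 ≤ (N ∩ I₂).card + (N ∩ I₃).card) :
    expect (conflictGraph z t (√2)) 0.068 I₁ I₂ I₃ C ≤
      2.395 * (1 - 0.068 * (depth z N I₂ + depth z N I₃)) := by
  have h1 := sqrt_two_lower
  obtain ⟨v, a, b, ⟨hvN, haN, hbN⟩, hvI, ha, hb, hva, hvb, hab, hd⟩ :=
    exists_three_of_card hv h hcard
  have hv0 := norm_nonneg (z v)
  have hv1 := hv.norm_lt_one v hvN
  have := expect_le_of_triple (p := 0.068) h (by norm_num) (by norm_num) hC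
    (exists_first_norm_le hv h.first) hvI ha hb hva hvb hab (by norm_num)
    (hv.norm_lt_one a haN).le (hv.norm_lt_one b hbN).le
  rcases hd with hd | hd <;> linarith

/-- The per-client inequality for `p = 0.068`. -/
theorem expect_le_mul
    (hv : ClientView z t V N w)
    (h : IsNestedQuasiIndep (conflictGraph z t) (√2) 1.395 (2 - √2) V I₁ I₂ I₃)
    (hC : ∀ S, ∀ i ∈ S, C S ≤ ‖z i‖)
    :
    expect (conflictGraph z t (√2)) 0.068 I₁ I₂ I₃ C ≤
      2.395 * (1 - depth z N I₁ - 0.068 * (depth z N I₂ + depth z N I₃)) := by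
  classical
  rcases (N ∩ I₁).eq_empty_or_nonempty with hemp | ⟨k, hk⟩
  · have hd1 : depth z N I₁ = 0 := by rw [depth, hemp, Finset.sum_empty]
    rw [hd1, sub_zero]
    have hdisj : Disjoint (N ∩ I₂) (N ∩ I₃) := by
      rw [Finset.disjoint_left]
      intro i hi hi'
      exact h.notMem_third_of_mem_second (Finset.mem_inter.1 hi).2 (Finset.mem_inter.1 hi').2
    have hdepth : depth z N I₂ + depth z N I₃ = ∑ i ∈ N ∩ I₂ ∪ N ∩ I₃, (1 - ‖z i‖) :=
      (Finset.sum_union hdisj).symm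
    have hunion := Finset.card_union_of_disjoint hdisj
    have hmem : ∀ i ∈ N ∩ I₂ ∪ N ∩ I₃, i ∈ N ∧ (i ∈ I₂ ∨ i ∈ I₃) := by
      intro i hi
      rwa [← Finset.inter_union_distrib_left, Finset.mem_inter, Finset.mem_union] at hi
    rcases Nat.lt_or_ge ((N ∩ I₂).card + (N ∩ I₃).card) 3 with hlt | hge
    · interval_cases hn : (N ∩ I₂).card + (N ∩ I₃).card
      · exact expect_le_of_card_eq_zero hv h hC hn
      · obtain ⟨v, hv1⟩ := Finset.card_eq_one.1 hunion
        obtain ⟨hvN, hvI⟩ := hmem v (by simp [hv1])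
        rw [hdepth, hv1, Finset.sum_singleton]
        exact expect_le_of_single hv h hC hvN hvI
      · obtain ⟨v, u, hvu, hv2⟩ := Finset.card_eq_two.1 hunion
        obtain ⟨hvN, hvI⟩ := hmem v (by simp [hv2])
        obtain ⟨huN, huI⟩ := hmem u (by simp [hv2])
        rw [hdepth, hv2, Finset.sum_pair hvu]
        exact expect_le_of_two hv h hC hvN hvI huN huI hvu
    · exact expect_le_of_three_le_card hv h hC hge
  · rw [Finset.mem_inter] at hk
    exact (expect_le_of_exists_first hv h hC hk.1 hk.2 (by norm_num) (by norm_num)).2 rfl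

end ClientExpectation

end EuclideanKMedian

namespace EuclideanKMedian

/-! ### The dual growing process -/

section DualGrowth

variable {d : ℕ} {D F : Type} [Fintype D] {x : D → Point d} {y : F → Point d}
  {lam : ℝ} {α : D → ℝ}

/-- The times `θ` at which, when the clients have the values `β θ`, some facility within
distance `θ` of client `j` is tight. -/
def tightTimes (x : D → Point d) (y : F → Point d) (lam : ℝ) (β : ℝ → D → ℝ) (j : D) : Set ℝ :=
  {θ | 0 ≤ θ ∧ ∃ i, lam ≤ dualLoad x y (β θ) i ∧ dist (x j) (y i) ≤ θ}

/-- Two processes have the same history up to the first stopping time of a client on which they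
disagree, so that client stops in both. -/
theorem isDualGrowth_unique {α β : D → ℝ} (hα : IsDualGrowth x y lam α)
    (hβ : IsDualGrowth x y lam β) : α = β := by
  classical
  by_contra hne
  obtain ⟨j₀, hj₀⟩ := Function.ne_iff.1 hne
  obtain ⟨j, hj, hmin⟩ := (Finset.univ.filter fun k => α k ≠ β k).exists_min_image
    (fun k => min (α k) (β k)) ⟨j₀, by simpa using hj₀⟩
  simp only [Finset.mem_filter, Finset.mem_univ, true_and] at hj hmin
  have key : ∀ θ ≤ min (α j) (β j), (fun k => min θ (α k)) = fun k => min θ (β k) := by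
    intro θ hθ
    funext k
    by_cases hk : α k = β k
    · rw [hk]
    · have := hθ.trans (hmin k hk)
      rw [min_eq_left (this.trans (min_le_left _ _)), min_eq_left (this.trans (min_le_right _ _))]
  rcases lt_or_gt_of_ne hj with h | h
  · obtain ⟨h0, i, hi, hd⟩ := (hα j).1
    rw [key _ (le_min le_rfl h.le)] at hi
    exact absurd ((hβ j).2 ⟨h0, i, hi, hd⟩) (not_le.2 h)
  · obtain ⟨h0, i, hi, hd⟩ := (hβ j).1
    rw [← key _ (le_min h.le le_rfl)] at hi
    exact absurd ((hα j).2 ⟨h0, i, hi, hd⟩) (not_le.2 h)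

variable [Fintype F]

/-- The set is closed, since loads are continuous and there are finitely many facilities; it is
nonempty, since a growing client alone brings any facility to load `lam` eventually. -/
theorem exists_isLeast_tightTimes [Nonempty F] {β : ℝ → D → ℝ} (hβ : ∀ j, Continuous fun θ => β θ j)
    {j : D} (hj : ∀ θ, β θ j = θ) : ∃ a, IsLeast (tightTimes x y lam β j) a := by
  have hclosed : IsClosed (tightTimes x y lam β j) := by
    have : tightTimes x y lam β j = Set.Ici 0 ∩
        ⋃ i, {θ | lam ≤ dualLoad x y (β θ) i} ∩ {θ | dist (x j) (y i) ≤ θ} := by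
      ext θ
      simp [tightTimes]
    rw [this]
    refine isClosed_Ici.inter (isClosed_iUnion_of_finite fun i => ?_)
    refine IsClosed.inter (isClosed_le continuous_const ?_) (isClosed_le continuous_const
      continuous_id)
    unfold dualLoad
    exact continuous_finsetSum _ fun k _ => ((hβ k).sub continuous_const).max continuous_const
  have hne : (tightTimes x y lam β j).Nonempty := by
    obtain ⟨i⟩ := ‹Nonempty F›
    refine ⟨dist (x j) (y i) + |lam|, by positivity, i, ?_, by linarith [abs_nonneg lam]⟩
    refine le_trans ?_ (Finset.single_le_sum (f := fun k => max (β (dist (x j) (y i) + |lam|) k -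
      dist (x k) (y i)) 0) (fun k _ => le_max_right _ _) (Finset.mem_univ j))
    refine le_trans ?_ (le_max_left _ _)
    rw [hj]
    linarith [le_abs_self lam]
  exact ⟨_, hclosed.isLeast_csInf hne ⟨0, fun θ hθ => hθ.1⟩⟩

open scoped Classical in
/-- The values at time `θ` when the clients of `B` are stopped at `α` and the others grow. -/
noncomputable def partialGrowth (B : Finset D) (α : D → ℝ) (θ : ℝ) (j : D) : ℝ :=
  if j ∈ B then min θ (α j) else θ

/-- Clients are stopped one at a time, always one with the earliest time. The last clause is the
invariant that the others stop no earlier; hence stopping the next client changes nothing before its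
own time. -/
theorem exists_partialGrowth [Nonempty F] (x : D → Point d) (y : F → Point d) (lam : ℝ) (n : ℕ)
    (hn : n ≤ Fintype.card D) : ∃ (B : Finset D) (α : D → ℝ), B.card = n ∧
      (∀ b ∈ B, IsLeast (tightTimes x y lam (partialGrowth B α) b) (α b)) ∧
      ∀ b ∈ B, ∀ j ∉ B, ∀ θ ∈ tightTimes x y lam (partialGrowth B α) j, α b ≤ θ := by
  classical
  induction n with
  | zero => exact ⟨∅, 0, by simp⟩
  | succ n ih =>
    obtain ⟨B, α, hB, hleast, hlater⟩ := ih (by omega)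
    have hcont : ∀ j, Continuous fun θ => partialGrowth B α θ j := by
      intro j
      unfold partialGrowth
      split_ifs
      · exact continuous_id.min continuous_const
      · exact continuous_id
    have hex : ∀ j, ∃ a, j ∉ B → IsLeast (tightTimes x y lam (partialGrowth B α) j) a := by
      intro j
      by_cases hj : j ∈ B
      · exact ⟨0, fun h => absurd hj h⟩
      · obtain ⟨a, ha⟩ := exists_isLeast_tightTimes (x := x) (y := y) (lam := lam) hcont (j := j)
          (fun θ => if_neg hj)
        exact ⟨a, fun _ => ha⟩
    choose a ha using hex
    have hne : (Bᶜ).Nonempty := by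
      rw [← Finset.card_pos, Finset.card_compl]
      omega
    obtain ⟨j, hj, hmin⟩ := (Bᶜ).exists_min_image a hne
    rw [Finset.mem_compl] at hj
    simp only [Finset.mem_compl] at hmin
    have hsame : ∀ θ ≤ a j, partialGrowth (insert j B) (Function.update α j (a j)) θ =
        partialGrowth B α θ := by
      intro θ hθ
      funext k
      unfold partialGrowth
      by_cases hk : k = j
      · subst hk
        rw [if_pos (Finset.mem_insert_self _ _), if_neg hj, Function.update_self, min_eq_left hθ]
      · rw [Function.update_of_ne hk]
        simp only [Finset.mem_insert, hk, false_or]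
    have hmem : ∀ k, ∀ θ ≤ a j,
        (θ ∈ tightTimes x y lam (partialGrowth (insert j B) (Function.update α j (a j))) k ↔
          θ ∈ tightTimes x y lam (partialGrowth B α) k) := by
      intro k θ hθ
      simp only [tightTimes, Set.mem_ofPred_eq, hsame θ hθ]
    have hext : ∀ k c, c ≤ a j → IsLeast (tightTimes x y lam (partialGrowth B α) k) c →
        IsLeast (tightTimes x y lam
          (partialGrowth (insert j B) (Function.update α j (a j))) k) c := by
      intro k c hc hk
      refine ⟨(hmem k c hc).2 hk.1, fun θ hθ => ?_⟩
      rcases le_total θ (a j) with h | h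
      · exact hk.2 ((hmem k θ h).1 hθ)
      · exact hc.trans h
    have hle : ∀ b ∈ B, α b ≤ a j := fun b hb => hlater b hb j hj _ (ha j hj).1
    have hval : ∀ b ∈ B, Function.update α j (a j) b = α b := fun b hb =>
      Function.update_of_ne (ne_of_mem_of_not_mem hb hj) _ _
    refine ⟨insert j B, Function.update α j (a j), ?_, ?_, ?_⟩
    · rw [Finset.card_insert_of_notMem hj, hB]
    · intro b hb
      rcases Finset.mem_insert.1 hb with rfl | hb
      · rw [Function.update_self]
        exact hext b _ le_rfl (ha b hj)
      · rw [hval b hb]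
        exact hext b _ (hle b hb) (hleast b hb)
    · intro b hb k hk θ hθ
      have hkB : k ∉ B := fun h => hk (Finset.mem_insert_of_mem h)
      have hb' : Function.update α j (a j) b ≤ a j := by
        rcases Finset.mem_insert.1 hb with rfl | hb
        · rw [Function.update_self]
        · rw [hval b hb]
          exact hle b hb
      rcases le_total θ (a j) with h | h
      · exact (hb'.trans (hmin k hkB)).trans ((ha k hkB).2 ((hmem k θ h).1 hθ))
      · exact hb'.trans h

theorem existsUnique_isDualGrowth [Nonempty F] (x : D → Point d) (y : F → Point d) (lam : ℝ) :
    ∃! α : D → ℝ, IsDualGrowth x y lam α := by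
  obtain ⟨B, α, hB, hleast, -⟩ := exists_partialGrowth x y lam (Fintype.card D) le_rfl
  have hu : B = Finset.univ := Finset.eq_univ_of_card B hB
  subst hu
  refine ⟨α, fun j => ?_, fun β hβ => isDualGrowth_unique hβ fun j => ?_⟩ <;>
  · have := hleast j (Finset.mem_univ j)
    have hα : partialGrowth Finset.univ α = fun θ k => min θ (α k) := by
      funext θ k
      exact if_pos (Finset.mem_univ k)
    rwa [hα] at this

end DualGrowth

/-! ### Feasibility, witnesses and weak duality -/

section DualSolution

variable {d : ℕ} {D F : Type} [Fintype D] {x : D → Point d} {y : F → Point d}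
  {lam : ℝ} {α : D → ℝ}

theorem IsDualGrowth.nonneg (h : IsDualGrowth x y lam α) (j : D) : 0 ≤ α j := (h j).1.1

/-- The value of no client that contributes to `i` exceeds the time at which `i` is tight. -/
theorem IsDualGrowth.le_of_tight (h : IsDualGrowth x y lam α) {θ : ℝ} (hθ : 0 ≤ θ) {i : F}
    (hi : lam ≤ dualLoad x y (fun k => min θ (α k)) i) {j : D} (hj : dist (x j) (y i) < α j) :
    α j ≤ θ := by
  by_contra! hlt
  -- At this time `i` is still tight and `j` has reached it, so `j` would stop before `α j`.
  have hm : max θ (dist (x j) (y i)) < α j := max_lt hlt hj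
  refine absurd ((h j).2 ⟨hθ.trans (le_max_left _ _), i, hi.trans ?_, le_max_right _ _⟩)
    (not_le.2 hm)
  refine Finset.sum_le_sum fun k _ => max_le_max (sub_le_sub_right ?_ _) le_rfl
  exact min_le_min (le_max_left _ _) le_rfl

/-- If `i` is overloaded, let `j` be its contributor with the largest `α`. The full load is attained
at time `α j`, so by continuity it exceeds `lam` strictly earlier, and `j` would have stopped by
then. -/
theorem IsDualGrowth.dualLoad_le (h : IsDualGrowth x y lam α) (hlam : 0 ≤ lam) (i : F) :
    dualLoad x y α i ≤ lam := by
  classical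
  by_contra! hlt
  have hne : (facilityNbrs x y α i).Nonempty := by
    by_contra hemp
    rw [Finset.not_nonempty_iff_eq_empty, facilityNbrs, Finset.filter_eq_empty_iff] at hemp
    have : dualLoad x y α i = 0 := by
      refine Finset.sum_eq_zero fun k hk => max_eq_right ?_
      linarith [not_lt.1 (hemp hk)]
    linarith
  obtain ⟨j, hj, hmax⟩ := (facilityNbrs x y α i).exists_max_image α hne
  simp only [facilityNbrs, Finset.mem_filter, Finset.mem_univ, true_and] at hj hmax
  have hpos : 0 < α j := dist_nonneg.trans_lt hj
  have hcont : Continuous fun θ => dualLoad x y (fun k => min θ (α k)) i := by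
    unfold dualLoad
    exact continuous_finsetSum _ fun k _ =>
      ((continuous_id.min continuous_const).sub continuous_const).max continuous_const
  have hval : dualLoad x y (fun k => min (α j) (α k)) i = dualLoad x y α i := by
    refine Finset.sum_congr rfl fun k _ => ?_
    beta_reduce
    rcases lt_or_ge (dist (x k) (y i)) (α k) with hk | hk
    · rw [min_eq_right (hmax k hk)]
    · rw [max_eq_right (by linarith [min_le_right (α j) (α k)]), max_eq_right (by linarith)]
  have hev : ∀ᶠ θ in nhdsWithin (α j) (Set.Iio (α j)),
      lam < dualLoad x y (fun k => min θ (α k)) i :=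
    (hcont.tendsto (α j)).mono_left nhdsWithin_le_nhds |>.eventually_const_lt (by rwa [hval])
  obtain ⟨θ, hθ1, hθ2, hθ3⟩ := (hev.and (Ioo_mem_nhdsLT hpos)).exists
  exact absurd (h.le_of_tight hθ2.le hθ1.le hj) (not_le.2 hθ3)

theorem facilityTime_nonneg (hα : ∀ j, 0 ≤ α j) (i : F) : 0 ≤ facilityTime x y α i := by
  classical
  unfold facilityTime
  split_ifs with h
  · obtain ⟨j, hj⟩ := h
    exact (hα j).trans (Finset.le_sup' α hj)
  · exact le_rfl

theorem le_facilityTime {i : F} {j : D} (h : dist (x j) (y i) < α j) :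
    α j ≤ facilityTime x y α i := by
  classical
  have hj : j ∈ facilityNbrs x y α i := by simpa [facilityNbrs] using h
  unfold facilityTime
  rw [dif_pos ⟨j, hj⟩]
  exact Finset.le_sup' α hj

variable [Fintype F]

open scoped Classical in
-- The witness of `j` is the facility that stops it: being tight at time `α j`, it has no
-- contributor with a larger value.
theorem exists_witnessSetup (hlam : 0 ≤ lam) (h : IsDualGrowth x y lam α) : ∃ w : D → F,
    WitnessSetup x y (tightFacilities x y lam α) α (facilityTime x y α)
      (fun j => (tightFacilities x y lam α).filter fun i => dist (x j) (y i) < α j) w := by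
  have hw : ∀ j, ∃ i, i ∈ tightFacilities x y lam α ∧ facilityTime x y α i ≤ α j ∧
      dist (x j) (y i) ≤ α j := by
    intro j
    obtain ⟨h0, i, hi, hd⟩ := (h j).1
    have hle : dualLoad x y (fun k => min (α j) (α k)) i ≤ dualLoad x y α i := by
      refine Finset.sum_le_sum fun k _ => ?_
      gcongr
      exact min_le_right _ _
    refine ⟨i, ?_, ?_, hd⟩
    · simp only [tightFacilities, Finset.mem_filter, Finset.mem_univ, true_and]
      exact le_antisymm (h.dualLoad_le hlam i) (hi.trans hle)
    · unfold facilityTime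
      split_ifs
      · refine Finset.sup'_le _ _ fun k hk => h.le_of_tight h0 hi ?_
        simpa [facilityNbrs] using hk
      · exact h0
  choose w hw using hw
  refine ⟨w, h.nonneg, fun i _ => facilityTime_nonneg h.nonneg i, fun j => Finset.filter_subset _ _,
    fun j => (hw j).1, fun j => (hw j).2.1, fun j => (hw j).2.2, fun j i hi => ?_, fun j i hi => ?_⟩
  · exact le_facilityTime (Finset.mem_filter.1 hi).2
  · exact (Finset.mem_filter.1 hi).2

/-- Weak duality. -/
theorem sum_le_opt [Nonempty F] (hα : ∀ j, 0 ≤ α j) (hload : ∀ i, dualLoad x y α i ≤ lam) :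
    ∑ j, α j ≤ opt x y lam := by
  refine le_csInf ?_ ?_
  · refine ⟨_, fun _ _ => 1, fun _ => 1, ⟨fun j => ?_, ?_, ?_, ?_⟩, rfl⟩
    · simpa using Nat.one_le_iff_ne_zero.2 (Fintype.card_ne_zero (α := F))
    all_goals simp
  · rintro v ⟨X, Y, hXY, rfl⟩
    have h1 : ∑ j, α j ≤ ∑ j, ∑ i, X i j * α j := by
      refine Finset.sum_le_sum fun j _ => ?_
      rw [← Finset.sum_mul]
      exact le_mul_of_one_le_left (hα j) (hXY.assigned j)
    have h2 : ∑ i, ∑ j, X i j * α j ≤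
        ∑ i, ∑ j, (X i j * dist (x j) (y i) + Y i * max (α j - dist (x j) (y i)) 0) := by
      refine Finset.sum_le_sum fun i _ => Finset.sum_le_sum fun j _ => ?_
      have a1 := mul_le_mul_of_nonneg_left (le_max_left (α j - dist (x j) (y i)) 0)
        (hXY.assign_nonneg i j)
      have a2 := mul_le_mul_of_nonneg_right (hXY.assign_le i j)
        (le_max_right (α j - dist (x j) (y i)) 0)
      linarith
    have h3 : ∑ i, ∑ j, (X i j * dist (x j) (y i) + Y i * max (α j - dist (x j) (y i)) 0) =
        (∑ i, ∑ j, X i j * dist (x j) (y i)) + ∑ i, Y i * dualLoad x y α i := by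
      simp only [Finset.sum_add_distrib, ← Finset.mul_sum, dualLoad]
    have h4 : ∑ i, Y i * dualLoad x y α i ≤ lam * ∑ i, Y i := by
      rw [Finset.mul_sum]
      refine Finset.sum_le_sum fun i _ => ?_
      rw [mul_comm lam]
      exact mul_le_mul_of_nonneg_left (hload i) (hXY.open_nonneg i)
    rw [Finset.sum_comm] at h1
    unfold lpValue
    linarith

end DualSolution

end EuclideanKMedian

namespace EuclideanKMedian

/-! ### Rescaling to one client, and the best factor -/

section PerClient

variable {d : ℕ} {D F : Type} {x : D → Point d} {y : F → Point d} {V : Finset F}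
  {α : D → ℝ} {t : F → ℝ} {N : D → Finset F} {w : D → F} {I₁ I₂ I₃ : Finset F} {p ρ : ℝ}

theorem conflictGraph_rescale (y : F → Point d) (t : F → ℝ) (c : Point d) {a : ℝ} (ha : 0 < a) :
    conflictGraph (fun i => a⁻¹ • (y i - c)) (fun i => a⁻¹ * t i) = conflictGraph y t := by
  have ha' : 0 < a⁻¹ := inv_pos.2 ha
  funext δ
  ext i k
  rw [conflictGraph_adj, conflictGraph_adj, ← smul_sub, sub_sub_sub_cancel_right, norm_smul,
    Real.norm_of_nonneg ha'.le, ← mul_min_of_nonneg _ _ ha'.le, mul_left_comm δ]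
  exact and_congr_right fun _ => mul_le_mul_iff_of_pos_left ha'

theorem WitnessSetup.clientView (hs : WitnessSetup x y V α t N w) {j : D} (hj : 0 < α j) :
    ClientView (fun i => (α j)⁻¹ • (y i - x j)) (fun i => (α j)⁻¹ * t i) V (N j) (w j) := by
  have hnorm : ∀ i, ‖(α j)⁻¹ • (y i - x j)‖ = (α j)⁻¹ * dist (x j) (y i) := by
    intro i
    rw [norm_smul, Real.norm_of_nonneg (inv_pos.2 hj).le, dist_comm, dist_eq_norm]
  refine ⟨hs.nbr_subset j, hs.witness_mem j, ?_, ?_, fun i hi => ?_, fun i hi => ?_⟩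
  · exact (inv_mul_le_one₀ hj).2 (hs.t_witness_le j)
  · rw [hnorm]
    exact (inv_mul_le_one₀ hj).2 (hs.dist_witness_le j)
  · exact (one_le_inv_mul₀ hj).2 (hs.alpha_le_t j i hi)
  · rw [hnorm]
    exact (inv_mul_lt_one₀ hj).2 (hs.dist_lt_alpha j i hi)

/-- The per-client inequality follows from the case of a client at the origin with `α = 1`. -/
theorem expect_clientCost_le_of_clientView [DecidableEq F] (hs : WitnessSetup x y V α t N w)
    (h : IsNestedQuasiIndep (conflictGraph y t) (√2) 1.395 (2 - √2) V I₁ I₂ I₃)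
    (hp0 : 0 ≤ p) (hp1 : 2 * p ≤ 1)
    (hρ : ∀ (z : F → Point d) (τ : F → ℝ) (N : Finset F) (w : F), ClientView z τ V N w →
      IsNestedQuasiIndep (conflictGraph z τ) (√2) 1.395 (2 - √2) V I₁ I₂ I₃ →
      ∀ C : Finset F → ℝ, (∀ S, ∀ i ∈ S, C S ≤ ‖z i‖) →
        expect (conflictGraph z τ (√2)) p I₁ I₂ I₃ C ≤
          ρ * (1 - depth z N I₁ - p * (depth z N I₂ + depth z N I₃))) (j : D) :
    expect (conflictGraph y t (√2)) p I₁ I₂ I₃ (fun S => clientCost x y j S) ≤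
      ρ * expect (conflictGraph y t (√2)) p I₁ I₂ I₃
        (fun S => α j - ∑ i ∈ N j ∩ S, (α j - dist (x j) (y i))) := by
  have hcost : ∀ S : Finset F, ∀ i ∈ S, clientCost x y j S ≤ dist (x j) (y i) := fun S i hi =>
    Metric.infDist_le_dist_of_mem (Set.mem_image_of_mem y (Finset.mem_coe.2 hi))
  rcases (hs.alpha_nonneg j).eq_or_lt with hj | hj
  -- If `α j = 0` there is nothing to rescale by. The witness coincides with the client and has `t ≤
  -- 0`, so a point of `I₁` coincides with the client too and the cost is 0.
  · have hN : N j = ∅ := by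
      refine Finset.eq_empty_of_forall_notMem fun i hi => ?_
      have := hs.dist_lt_alpha j i hi
      rw [← hj] at this
      exact absurd dist_nonneg (not_le.2 this)
    have hw0 : dist (x j) (y (w j)) = 0 :=
      le_antisymm (hj ▸ hs.dist_witness_le j) dist_nonneg
    obtain ⟨k, hk, hwk⟩ := h.first.exists_near (hs.witness_mem j)
    have hk0 : dist (x j) (y k) ≤ 0 := by
      rcases hwk with rfl | hadj
      · exact hw0.le
      · have h1 : √2 * min (t (w j)) (t k) ≤ √2 * 0 := by
          gcongr
          exact (min_le_left _ _).trans (hj ▸ hs.t_witness_le j)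
        linarith [dist_triangle (x j) (y (w j)) (y k), hadj.2]
    have hle : expect (conflictGraph y t (√2)) p I₁ I₂ I₃ (fun S => clientCost x y j S) ≤
        expect (conflictGraph y t (√2)) p I₁ I₂ I₃ (fun _ => 0) :=
      expect_mono hp0 hp1 fun _ _ _ =>
        (hcost _ k (mem_centers.2 (Or.inl hk))).trans hk0
    refine hle.trans (le_of_eq ?_)
    simp only [hN, ← hj, Finset.empty_inter, Finset.sum_empty, sub_zero, expect_const, mul_zero]
  · set z : F → Point d := fun i => (α j)⁻¹ • (y i - x j) with hz
    have hnorm : ∀ i, ‖z i‖ = (α j)⁻¹ * dist (x j) (y i) := by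
      intro i
      rw [hz, norm_smul, Real.norm_of_nonneg (inv_pos.2 hj).le, dist_comm, dist_eq_norm]
    have hG := conflictGraph_rescale y t (x j) hj
    have h' := h
    rw [← hG] at h'
    have key := hρ z _ (N j) (w j) (hs.clientView hj) h' (fun S => (α j)⁻¹ * clientCost x y j S)
      fun S i hi => by
        rw [hnorm]
        exact mul_le_mul_of_nonneg_left (hcost S i hi) (inv_pos.2 hj).le
    rw [← expect_one_sub_sum h', hG, expect_const_mul] at key
    have hden : (fun S => α j - ∑ i ∈ N j ∩ S, (α j - dist (x j) (y i))) =
        fun S => α j * (1 - ∑ i ∈ N j ∩ S, (1 - ‖z i‖)) := by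
      funext S
      rw [mul_sub, mul_one, Finset.mul_sum]
      congr 1
      refine Finset.sum_congr rfl fun i _ => ?_
      rw [hnorm, mul_sub, mul_one, mul_inv_cancel_left₀ hj.ne']
    rw [hden, expect_const_mul]
    have := mul_le_mul_of_nonneg_left key hj.le
    rwa [mul_inv_cancel_left₀ hj.ne', mul_left_comm] at this

end PerClient

/-- `r` is a valid factor in the per-client inequality for the algorithm with parameter `p`. -/
def IsClientRatio (p r : ℝ) : Prop :=
  ∀ (d : ℕ) (D F : Type) [DecidableEq F] (x : D → Point d) (y : F → Point d)
    (V : Finset F) (α : D → ℝ) (t : F → ℝ) (N : D → Finset F) (w : D → F),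
    WitnessSetup x y V α t N w →
    ∀ I₁ I₂ I₃ : Finset F,
    IsNestedQuasiIndep (conflictGraph y t) (√2) 1.395 (2 - √2) V I₁ I₂ I₃ →
    ∀ j : D,
      expect (conflictGraph y t (√2)) p I₁ I₂ I₃ (fun S => clientCost x y j S) ≤
        r * expect (conflictGraph y t (√2)) p I₁ I₂ I₃
          (fun S => α j - ∑ i ∈ N j ∩ S, (α j - dist (x j) (y i)))

theorem isClientRatio_of_lt {p : ℝ} (hp0 : 0 ≤ p) (hp1 : p < 0.337) : IsClientRatio p 200 := by
  intro d D F _ x y V α t N w hs I₁ I₂ I₃ h j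
  exact expect_clientCost_le_of_clientView hs h hp0 (by linarith)
    (fun z τ N w hv h C hC => expect_le_of_lt hv h hC hp0 hp1) j

theorem isClientRatio_main : IsClientRatio 0.068 2.395 := by
  intro d D F _ x y V α t N w hs I₁ I₂ I₃ h j
  exact expect_clientCost_le_of_clientView hs h (by norm_num) (by norm_num)
    (fun z τ N w hv h C hC => expect_le_mul hv h hC) j

/-- The best nonnegative factor in the per-client inequality for the parameter `p`. -/
noncomputable def bestClientRatio (p : ℝ) : ℝ := sInf {r | 0 ≤ r ∧ IsClientRatio p r}

theorem bestClientRatio_le {p r : ℝ} (hr : 0 ≤ r) (h : IsClientRatio p r) :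
    bestClientRatio p ≤ r :=
  csInf_le ⟨0, fun _ hs => hs.1⟩ ⟨hr, h⟩

/-- Each instance of the inequality is a closed condition on the factor, and 200 satisfies them all,
so the infimum is itself valid. -/
theorem isClientRatio_bestClientRatio {p : ℝ} (hp0 : 0 ≤ p) (hp1 : p < 0.337) :
    IsClientRatio p (bestClientRatio p) := by
  intro d D F _ x y V α t N w hs I₁ I₂ I₃ h j
  have hmem : bestClientRatio p ∈ closure {r | 0 ≤ r ∧ IsClientRatio p r} :=
    csInf_mem_closure ⟨200, by norm_num, isClientRatio_of_lt hp0 hp1⟩ ⟨0, fun _ hs => hs.1⟩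
  have hclosed : IsClosed {r | expect (conflictGraph y t (√2)) p I₁ I₂ I₃
      (fun S => clientCost x y j S) ≤ r * expect (conflictGraph y t (√2)) p I₁ I₂ I₃
        (fun S => α j - ∑ i ∈ N j ∩ S, (α j - dist (x j) (y i)))} :=
    isClosed_le continuous_const (continuous_id.mul continuous_const)
  exact closure_minimal (fun r hr => hr.2 d D F x y V α t N w hs I₁ I₂ I₃ h j) hclosed hmem

/-! ### The approximation guarantee -/

section Guarantee

variable {d : ℕ} {D F : Type} [Fintype D] [Fintype F] {x : D → Point d} {y : F → Point d}
  {lam : ℝ} {α : D → ℝ}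

open scoped Classical in
/-- The clients pay `λ` for each tight facility. -/
theorem sum_sum_alpha_sub_dist {S : Finset F} (hS : S ⊆ tightFacilities x y lam α) :
    ∑ j, ∑ i ∈ (tightFacilities x y lam α).filter (fun i => dist (x j) (y i) < α j) ∩ S,
      (α j - dist (x j) (y i)) = lam * S.card := by
  have h1 : ∀ j, ∑ i ∈ (tightFacilities x y lam α).filter (fun i => dist (x j) (y i) < α j) ∩ S,
      (α j - dist (x j) (y i)) = ∑ i ∈ S, max (α j - dist (x j) (y i)) 0 := by
    intro j
    have h2 : (tightFacilities x y lam α).filter (fun i => dist (x j) (y i) < α j) ∩ S =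
        S.filter fun i => dist (x j) (y i) < α j := by
      ext i
      simp only [Finset.mem_inter, Finset.mem_filter]
      exact ⟨fun h => ⟨h.2, h.1.2⟩, fun h => ⟨⟨hS h.1, h.2⟩, h.1⟩⟩
    rw [h2, Finset.sum_filter]
    refine Finset.sum_congr rfl fun i _ => ?_
    split_ifs with hlt
    · rw [max_eq_left (by linarith)]
    · rw [max_eq_right (by linarith)]
  simp only [h1]
  rw [Finset.sum_comm]
  have h3 : ∀ i ∈ S, ∑ j, max (α j - dist (x j) (y i)) 0 = lam := by
    intro i hi
    exact (Finset.mem_filter.1 (hS hi)).2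
  rw [Finset.sum_congr rfl h3, Finset.sum_const, nsmul_eq_mul, mul_comm]

/-- Every center is tight, so summing the per-client inequality leaves `∑ α j` minus `lam` per
center, and `∑ α j` is at most the optimum by weak duality. -/
theorem expect_sum_clientCost_le [Nonempty F] (hlam : 0 ≤ lam) (hα : IsDualGrowth x y lam α)
    {I₁ I₂ I₃ : Finset F}
    (h : IsNestedQuasiIndep (conflictGraph y (facilityTime x y α)) (√2) 1.395 (2 - √2)
      (tightFacilities x y lam α) I₁ I₂ I₃) {p r : ℝ} (hp0 : 0 ≤ p) (hp1 : 2 * p ≤ 1)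
    (hr0 : 0 ≤ r) (hr : IsClientRatio p r) :
    expect (conflictGraph y (facilityTime x y α) (√2)) p I₁ I₂ I₃
        (fun S => ∑ j, clientCost x y j S) ≤
      r * (opt x y lam - lam * expect (conflictGraph y (facilityTime x y α) (√2)) p I₁ I₂ I₃
        (fun S => (S.card : ℝ))) := by
  classical
  obtain ⟨w, hw⟩ := exists_witnessSetup hlam hα
  rw [expect_sum]
  refine (Finset.sum_le_sum fun j _ => hr d D F x y _ α _ _ w hw I₁ I₂ I₃ h j).trans ?_
  rw [← Finset.mul_sum, ← expect_sum]
  refine mul_le_mul_of_nonneg_left ?_ hr0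
  have hle : expect (conflictGraph y (facilityTime x y α) (√2)) p I₁ I₂ I₃ (fun S => ∑ j,
      (α j - ∑ i ∈ (tightFacilities x y lam α).filter (fun i => dist (x j) (y i) < α j) ∩ S,
        (α j - dist (x j) (y i)))) ≤
      expect (conflictGraph y (facilityTime x y α) (√2)) p I₁ I₂ I₃
        (fun S => ∑ j, α j - lam * (S.card : ℝ)) := by
    refine expect_mono hp0 hp1 fun heads _ marked => le_of_eq ?_
    rw [Finset.sum_sub_distrib, sum_sum_alpha_sub_dist (h.centers_subset heads marked)]
  rw [expect_sub, expect_const, expect_const_mul] at hle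
  linarith [sum_le_opt hα.nonneg (hα.dualLoad_le hlam)]

end Guarantee

end EuclideanKMedian

open EuclideanKMedian in
theorem mainTheorem4 :
    ∃ ρ : ℝ → ℝ,
      -- the per-client inequality, with a constant that depends on `p` only
      (∀ p : ℝ, 0 ≤ p → p < 0.337 →
        ∀ (d : ℕ) (D F : Type) [DecidableEq F] (x : D → Point d) (y : F → Point d)
          (V : Finset F) (α : D → ℝ) (t : F → ℝ) (N : D → Finset F) (w : D → F),
        WitnessSetup x y V α t N w →
        ∀ I₁ I₂ I₃ : Finset F,
        IsNestedQuasiIndep (conflictGraph y t) (√2) 1.395 (2 - √2) V I₁ I₂ I₃ →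
        ∀ j : D,
          expect (conflictGraph y t (√2)) p I₁ I₂ I₃ (fun S => clientCost x y j S) ≤
            ρ p * expect (conflictGraph y t (√2)) p I₁ I₂ I₃
              (fun S => α j - ∑ i ∈ N j ∩ S, (α j - dist (x j) (y i)))) ∧
      ρ 0.068 ≤ 2.395 ∧
      -- the algorithm with `p = 0.068`, run on the tight facilities of the dual solution that the
      -- growing process produces, is an LMP 2.395-approximation in expectation
      (∀ (d : ℕ) (D F : Type) [Fintype D] [Fintype F] [Nonempty F]
          (x : D → Point d) (y : F → Point d) (lam : ℝ), 0 ≤ lam →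
        (∃! α : D → ℝ, IsDualGrowth x y lam α) ∧
        ∀ α : D → ℝ, IsDualGrowth x y lam α →
        ∀ I₁ I₂ I₃ : Finset F,
        IsNestedQuasiIndep (conflictGraph y (facilityTime x y α)) (√2) 1.395 (2 - √2)
          (tightFacilities x y lam α) I₁ I₂ I₃ →
          expect (conflictGraph y (facilityTime x y α) (√2)) 0.068 I₁ I₂ I₃
              (fun S => ∑ j, clientCost x y j S) ≤
            2.395 * (opt x y lam -
              lam * expect (conflictGraph y (facilityTime x y α) (√2)) 0.068 I₁ I₂ I₃
                (fun S => (S.card : ℝ)))) := by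
  refine ⟨bestClientRatio, fun p hp0 hp1 => isClientRatio_bestClientRatio hp0 hp1,
    bestClientRatio_le (by norm_num) isClientRatio_main, ?_⟩
  intro d D F _ _ _ x y lam hlam
  refine ⟨existsUnique_isDualGrowth x y lam, fun α hα I₁ I₂ I₃ h => ?_⟩
  exact expect_sum_clientCost_le hlam hα h (by norm_num) (by norm_num) (by norm_num)
    isClientRatio_main
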